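/- **Theorem (Factorization of the $D$-resultant, different denominators).** Let $K$ be a field of characteristic zero and let $A,B,C,D\in K[t]$ with $C,D\neq0$, $\gcd(A,C)=\gcd(B,D)=1$, be such that the parameterization $\left(\frac{A(t)}{C(t)},\frac{B(t)}{D(t)}\right)$ is proper, i.e. birational onto its image: $K\left(\frac AC,\frac BD\right)=K(t)$. Put $n_1=\max\{\deg A,\deg C\}$, $n_2=\max\{\deg B,\deg D\}$, let $\tilde A,\tilde C$ (resp. $\tilde B,\tilde D$) be the homogenizations of $A,C$ (resp. $B,D$) to degree $n_1$ (resp. $n_2$), and define the $D$-resultant $$\tilde\Delta_{\tilde A,\tilde C,\tilde B,\tilde D}(t,u):=\mathrm{Res}_{(s,v)}\left(\frac{\tilde A(s,v)\tilde C(t,u)-\tilde A(t,u)\tilde C(s,v)}{su-tv},\ \frac{\tilde B(s,v)\tilde D(t,u)-\tilde B(t,u)\tilde D(s,v)}{su-tv}\right),$$ the Sylvester resultant of forms in $(s,v)$ of degrees $n_1-1$ and $n_2-1$. Let $\tilde c$ be a least common multiple of $\tilde C$ and $\tilde D$, write $\tilde c=h\tilde C=q\tilde D$, let $\delta$ be a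 greatest common divisor of $\tilde C$ and $\tilde D$, and put $\tilde a=h\tilde A$, $\tilde b=q\tilde B$. Let $n=\deg\tilde c$ and assume $n\geq2$. Let $\{p,q'\}$ be a $\mu$-basis of $\nu=(\tilde a:\tilde b:\tilde c)$, i.e. a basis of the $K[s,v]$-module of syzygies of $(\tilde a,\tilde b,\tilde c)$ with $p=(p_1,p_2,p_3)$ and $q'=(q'_1,q'_2,q'_3)$ homogeneous of degrees $\mu\leq n-\mu$. Let $\mathrm{SRes}(p,q')\in K[x_1,x_2,x_3]$ be the first principal subresultant, with respect to $(s,v)$, of $\sum_i x_ip_i(s,v)$ and $\sum_i x_iq'_i(s,v)$, namely the determinant of order $n-2$ formed by the coefficients of $s,s^2,\dots,s^{n-2}$ in $s^i\sum_k x_kp_k(s,1)$ $(0\le i\le n-\mu-2)$ and $s^j\sum_k x_kq'_k(s,1)$ $(0\le j\le\mu-2)$. Then there is a form $\Delta_\nu(t,u)\in K[t,u]$ of degree $(n-1)(n-2)$ with $$\mathrm{SRes}(p,q')\big(\tilde a(t,u),\tilde b(t,u),\tilde c(t,u)\big)=u^{n-2}\,\Delta_\nu(t,u)$$ (so that $\Delta_\nu(t,1)=\mathrm{SRes}(p,q')(\tilde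 a(t,1),\tilde b(t,1),\tilde c(t,1))$), and there is a nonzero constant $\gamma\in K$ such that $$h(t,u)^{\deg(h)-1}\,q(t,u)^{\deg(q)-1}\,\tilde\Delta_{\tilde A,\tilde C,\tilde B,\tilde D}(t,u)=\gamma\,\delta(t,u)^{\deg(\delta)-1}\,\Delta_\nu(t,u),$$ where an exponent $-1$, which occurs only on a nonzero constant, is read as $0$. -/

import Mathlib

open Polynomial

namespace DResultant

/-- Binary forms over `R` live in `R[s, v]` (also written `R[t, u]`): `X 0` is `s` (or `t`) and
`X 1` is `v` (or `u`). -/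
abbrev BinPoly (R : Type*) [CommRing R] := MvPolynomial (Fin 2) R

/-- The polynomial `f(X, 1)` obtained from `f(s, v)` by setting `s = X`, `v = 1`. -/
noncomputable def dehom {R : Type*} [CommRing R] (f : BinPoly R) : R[X] :=
  MvPolynomial.aeval ![(X : R[X]), 1] f

/-- The Sylvester resultant, eliminating the homogeneous variables `(s, v)`, of a form `f` of
degree `d` and a form `g` of degree `e` with coefficients in `R`. -/
noncomputable def formResultant {R : Type*} [CommRing R] (f g : BinPoly R) (d e : ℕ) : R :=
  Polynomial.resultant (dehom f) (dehom g) d e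

/-- The first principal subresultant, with respect to the homogeneous variables `(s, v)`, of a
form `f` of degree `d` and a form `g` of degree `e`: the minor of the Sylvester matrix of size
`d + e - 2` whose rows belong to `s ^ i * f` for `i < e - 1` and `s ^ j * g` for `j < d - 1`
(after setting `v = 1`), and whose columns hold their coefficients of `s ^ 1, …, s ^ (d + e - 2)`.
For `d = e = 1` it is the empty determinant `1`. -/
noncomputable def firstPrincipalSubresultant {R : Type*} [CommRing R]
    (f g : BinPoly R) (d e : ℕ) : R :=
  (Matrix.of fun (i k : Fin ((e - 1) + (d - 1))) =>
    Fin.addCases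
      (fun i₁ : Fin (e - 1) => (X ^ (i₁ : ℕ) * dehom f).coeff ((k : ℕ) + 1))
      (fun i₂ : Fin (d - 1) => (X ^ (i₂ : ℕ) * dehom g).coeff ((k : ℕ) + 1)) i).det

section

variable {K : Type*} [Field K]

/-- `f(s, v) g(t, u) - f(t, u) g(s, v)`, a polynomial in `s, v` with coefficients in `K[t, u]`. -/
noncomputable def bracket (f g : BinPoly K) : BinPoly (BinPoly K) :=
  MvPolynomial.map MvPolynomial.C f * MvPolynomial.C g -
    MvPolynomial.C f * MvPolynomial.map MvPolynomial.C g

/-- `s u - t v`, as a polynomial in `s, v` with coefficients in `K[t, u]`. -/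
noncomputable def diagonalForm (K : Type*) [Field K] : BinPoly (BinPoly K) :=
  MvPolynomial.X 0 * MvPolynomial.C (MvPolynomial.X 1) -
    MvPolynomial.C (MvPolynomial.X 0) * MvPolynomial.X 1

theorem diagonalForm_dvd_bracket {f g : BinPoly K} {N : ℕ} (hf : f.IsHomogeneous N)
    (hg : g.IsHomogeneous N) : diagonalForm K ∣ bracket f g := by
  have key : ∀ x y z w : BinPoly (BinPoly K), ∀ k l m n : ℕ, k + l = m + n → m ≤ k →
      (x * w - z * y) ∣ (x ^ k * y ^ l * (z ^ m * w ^ n) - z ^ k * w ^ l * (x ^ m * y ^ n)) := by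
    intro x y z w k l m n h hmk
    obtain ⟨d, rfl⟩ := Nat.exists_eq_add_of_le hmk
    obtain rfl : n = l + d := by omega
    have e : x ^ (m + d) * y ^ l * (z ^ m * w ^ (l + d)) -
        z ^ (m + d) * w ^ l * (x ^ m * y ^ (l + d)) =
        ((x * w) ^ d - (z * y) ^ d) * (x ^ m * y ^ l * z ^ m * w ^ l) := by ring
    rw [e]
    exact Dvd.dvd.mul_right (sub_dvd_pow_sub_pow _ _ _) _
  have key2 : ∀ x y z w : BinPoly (BinPoly K), ∀ k l m n : ℕ, k + l = m + n →
      (x * w - z * y) ∣ (x ^ k * y ^ l * (z ^ m * w ^ n) - z ^ k * w ^ l * (x ^ m * y ^ n)) := by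
    intro x y z w k l m n h
    rcases le_total m k with hmk | hmk
    · exact key x y z w k l m n h hmk
    · have := (key x y z w m n k l h.symm hmk)
      rw [← dvd_neg] at this
      convert this using 1
      ring
  have expand : ∀ (f : BinPoly K),
      f = ∑ i ∈ f.support, MvPolynomial.C (f.coeff i) *
        (MvPolynomial.X 0 ^ i 0 * MvPolynomial.X 1 ^ i 1) := by
    intro f
    conv_lhs => rw [f.as_sum]
    refine Finset.sum_congr rfl fun i _ => ?_
    rw [MvPolynomial.monomial_eq, Finsupp.prod_fintype _ _ (by simp), Fin.prod_univ_two]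
  have hdeg : ∀ {f : BinPoly K}, f.IsHomogeneous N → ∀ i ∈ f.support, i 0 + i 1 = N := by
    intro f hf i hi
    have := hf (MvPolynomial.mem_support_iff.mp hi)
    rw [Finsupp.weight_apply, Finsupp.sum_fintype _ _ (by simp), Fin.sum_univ_two] at this
    simpa using this
  unfold bracket
  rw [expand f, expand g]
  simp only [map_sum, Finset.sum_mul_sum, ← Finset.sum_sub_distrib, map_mul, map_pow,
    MvPolynomial.map_C, MvPolynomial.map_X]
  refine Finset.dvd_sum fun i hi => Finset.dvd_sum fun j hj => ?_
  have := key2 (MvPolynomial.X 0) (MvPolynomial.X 1) (MvPolynomial.C (MvPolynomial.X 0))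
    (MvPolynomial.C (MvPolynomial.X 1)) (i 0) (i 1) (j 0) (j 1)
    ((hdeg hf i hi).trans (hdeg hg j hj).symm)
  refine dvd_trans this (Dvd.intro_left
    (MvPolynomial.C (MvPolynomial.C (f.coeff i)) * MvPolynomial.C (MvPolynomial.C (g.coeff j))) ?_)
  ring

open Classical in
/-- The quotient `(f(s, v) g(t, u) - f(t, u) g(s, v)) / (s u - t v)`; the division is exact when
`f` and `g` are forms of the same degree. -/
noncomputable def bracketQuotient (f g : BinPoly K) : BinPoly (BinPoly K) :=
  if h : diagonalForm K ∣ bracket f g then h.choose else 0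

theorem diagonalForm_mul_bracketQuotient {f g : BinPoly K} {N : ℕ} (hf : f.IsHomogeneous N)
    (hg : g.IsHomogeneous N) : diagonalForm K * bracketQuotient f g = bracket f g := by
  have h := diagonalForm_dvd_bracket hf hg
  rw [bracketQuotient, dif_pos h]
  exact h.choose_spec.symm

/-- The D-resultant in `K[t, u]` of four forms: `a₁, c₁` of degree `n₁` and `a₂, c₂` of degree
`n₂`. The two quotients are forms in `(s, v)` of degrees `n₁ - 1` and `n₂ - 1`. -/
noncomputable def dResultant (a₁ c₁ a₂ c₂ : BinPoly K) (n₁ n₂ : ℕ) : BinPoly K :=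
  formResultant (bracketQuotient a₁ c₁) (bracketQuotient a₂ c₂) (n₁ - 1) (n₂ - 1)

/-- The affine parameterization `(A / C, B / D)` is proper, that is, birational onto the closure
of its image: the two coordinate functions generate the function field of the line. -/
def IsProperParam (A C B D : K[X]) : Prop :=
  IntermediateField.adjoin K
    ({algebraMap K[X] (RatFunc K) A / algebraMap K[X] (RatFunc K) C,
      algebraMap K[X] (RatFunc K) B / algebraMap K[X] (RatFunc K) D} : Set (RatFunc K)) = ⊤

/-- The module of syzygies of three forms `(a, b, c) = (φ 0, φ 1, φ 2)`. -/
def syzygies (φ : Fin 3 → BinPoly K) : Submodule (BinPoly K) (Fin 3 → BinPoly K) where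
  carrier := {g | ∑ i, g i * φ i = 0}
  add_mem' := by
    intro g g' hg hg'
    simp only [Set.mem_ofPred_eq] at *
    simp [add_mul, Finset.sum_add_distrib, hg, hg']
  zero_mem' := by simp
  smul_mem' := by
    intro r g hg
    simp only [Set.mem_ofPred_eq] at *
    simp [mul_assoc, ← Finset.mul_sum, hg]

/-- `(p, q)` is a μ-basis of the parameterization `φ` by forms of degree `n`: a basis of the
module of syzygies of `φ` made of homogeneous elements of degrees `μ ≤ n - μ`. -/
structure IsMuBasis (φ : Fin 3 → BinPoly K) (n μ : ℕ) (p q : Fin 3 → BinPoly K) : Prop where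
  two_mul_le : 2 * μ ≤ n
  homogeneous_p : ∀ i, (p i).IsHomogeneous μ
  homogeneous_q : ∀ i, (q i).IsHomogeneous (n - μ)
  linearIndependent : LinearIndependent (BinPoly K) ![p, q]
  span_eq : Submodule.span (BinPoly K) {p, q} = syzygies φ

/-- The bihomogeneous form `∑ x_i p_i(s, v)`, as a polynomial in `(s, v)` with coefficients in
`K[x_1, x_2, x_3]`. -/
noncomputable def movingLine (p : Fin 3 → BinPoly K) : BinPoly (MvPolynomial (Fin 3) K) :=
  ∑ i, MvPolynomial.C (MvPolynomial.X i) * MvPolynomial.map MvPolynomial.C (p i)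

/-- `SRes(p, q) ∈ K[x_1, x_2, x_3]`, the first principal subresultant with respect to `(s, v)` of
`∑ x_i p_i(s, v)` and `∑ x_i q_i(s, v)`, where the `p_i` have degree `d` and the `q_i` have
degree `e`. -/
noncomputable def sRes (p q : Fin 3 → BinPoly K) (d e : ℕ) : MvPolynomial (Fin 3) K :=
  firstPrincipalSubresultant (movingLine p) (movingLine q) d e

/-- `Δ(t, u)` is the form of degree `(n - 1)(n - 2)` attached to the μ-basis `(p, q)` of the
parameterization `φ` of degree `n`: it is given by `SRes(p, q)` evaluated at `φ(t, u)`. That value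
is a form of degree `n (n - 2)`, in which the last variable `u` occurs as the extraneous factor
`u ^ (n - 2)`; so `Δ(t, 1) = SRes(p, q)(φ(t, 1))`. -/
structure IsSubresultantForm (φ : Fin 3 → BinPoly K) (n μ : ℕ) (p q : Fin 3 → BinPoly K)
    (Δ : BinPoly K) : Prop where
  homogeneous : Δ.IsHomogeneous ((n - 1) * (n - 2))
  eval_eq : MvPolynomial.aeval φ (sRes p q μ (n - μ)) = MvPolynomial.X 1 ^ (n - 2) * Δ

end

/-- `d` is a greatest common divisor of `x` and `y`. -/
def IsGcd {R : Type*} [CommRing R] (d x y : R) : Prop :=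
  d ∣ x ∧ d ∣ y ∧ ∀ e, e ∣ x → e ∣ y → e ∣ d

/-- `m` is a least common multiple of `x` and `y`. -/
def IsLcm {R : Type*} [CommRing R] (m x y : R) : Prop :=
  x ∣ m ∧ y ∣ m ∧ ∀ e, x ∣ e → y ∣ e → m ∣ e

end DResultant

/-! Write L = uX - t for su - tv at s = X, v = 1, and C̃ = qδ, D̃ = hδ. The two brackets, and the
two moving lines of the μ-basis evaluated at ν(t,u), vanish at (s:v) = (t:u). Each is therefore L
times a cofactor: F₁, F₂ for the brackets, P, Q for the lines. The common factor L collapses the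
subresultant to u^(n-2) Res(Q,P) (`firstPrincipalSubresultant_of_linear_mul`), so Δ_ν = Res(Q,P),
and what remains is to compare Res(F₁,F₂) with Res(Q,P).

Every syzygy of (hÃ, qB̃, hqδ) has the shape (q p₁, h p₂, p₃). The Hilbert-Burch relation
(`exists_cross_eq`) says that the cross product of the two reduced syzygies is κ(Ã, B̃, δ) with a
nonzero constant κ. With the coefficients h, q taken at (t,u) and the other factors at X, this
yields κhF₁ = p₂Q - q₂P and p₂qF₂ = -δP - h p₁F₁. Since a resultant is multiplicative and unchanged
by adding multiples of the other argument, up to sign Res(F₁,p₂) q^(n₁-1) Res(F₁,F₂) = Res(F₁,δ)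
Res(F₁,P), (κh)^(μ-1) Res(F₁,P) = Res(p₂,P) Res(Q,P). Modulo p₂ the polynomials P and F₁ are
proportional, which relates Res(p₂,P) to Res(p₂,F₁); modulo δ one has LF₁ = (qδ)(t,u)Ã, which gives
Res(δ,F₁), as Res(δ,L) = ±δ(t,u). The combination is `resultant_comparison`: only powers of h, q, δ
at (t,u) survive, besides resultants of coprime forms over K, which are nonzero constants.

Properness serves to exclude the degenerate degrees n₁ = 0, n₂ = 0 and μ = 0. -/

namespace DResultant

/-! ### Resultants with formal degrees, and the subresultant of multiples of a linear polynomial -/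

section Resultant

variable {R : Type*} [CommRing R]

/-- The degrees are formal bounds, as for forms that may vanish at infinity; each unit of surplus on
the right contributes a factor `f.coeff m`, and surpluses add. -/
theorem resultant_mul_right_of_le (f g₁ g₂ : R[X]) {m a b : ℕ} (hf : f.natDegree ≤ m)
    (h₁ : g₁.natDegree ≤ a) (h₂ : g₂.natDegree ≤ b) :
    resultant f (g₁ * g₂) m (a + b) = resultant f g₁ m a * resultant f g₂ m b := by
  obtain ⟨c, rfl⟩ := Nat.exists_eq_add_of_le h₁
  obtain ⟨d, rfl⟩ := Nat.exists_eq_add_of_le h₂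
  rw [show g₁.natDegree + c + (g₂.natDegree + d) = g₁.natDegree + g₂.natDegree + (c + d) by ring,
    resultant_add_right_deg _ _ _ _ _ natDegree_mul_le, resultant_mul_right _ _ _ _ hf,
    resultant_add_right_deg _ _ _ _ _ le_rfl, resultant_add_right_deg _ _ _ _ _ le_rfl]
  ring

theorem resultant_mul_left_of_le (f₁ f₂ g : R[X]) {a b n : ℕ} (hg : g.natDegree ≤ n)
    (h₁ : f₁.natDegree ≤ a) (h₂ : f₂.natDegree ≤ b) :
    resultant (f₁ * f₂) g (a + b) n = resultant f₁ g a n * resultant f₂ g b n := by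
  rw [resultant_comm, resultant_mul_right_of_le g f₁ f₂ hg h₁ h₂, resultant_comm f₁ g a n,
    resultant_comm f₂ g b n, Nat.add_mul, pow_add]
  ring

/-- The case `p = 0` is separate because `natDegree 0 = 0` would demand `m ≤ n`. -/
theorem resultant_add_mul_right_of_le (f g p : R[X]) {m n : ℕ}
    (hp : p = 0 ∨ p.natDegree + m ≤ n) (hf : f.natDegree ≤ m) :
    resultant f (g + f * p) m n = resultant f g m n := by
  rcases hp with rfl | hp
  · rw [mul_zero, add_zero]
  · exact resultant_add_mul_right _ _ _ _ _ hp hf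

theorem resultant_add_mul_left_of_le (f g p : R[X]) {m n : ℕ}
    (hp : p = 0 ∨ p.natDegree + n ≤ m) (hg : g.natDegree ≤ n) :
    resultant (f + g * p) g m n = resultant f g m n := by
  rcases hp with rfl | hp
  · rw [mul_zero, add_zero]
  · exact resultant_add_mul_left _ _ _ _ _ hp hg

/-- A common linear factor `u X - t` of two polynomials leaves the first principal subresultant as
a power of `u` times the resultant of the cofactors. -/
theorem firstPrincipalSubresultant_of_linear_mul {f g : BinPoly R} {F G : R[X]} {t u : R}
    {d e : ℕ} (hF : F.natDegree ≤ d - 1) (hG : G.natDegree ≤ e - 1)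
    (hf : dehom f = (C u * X - C t) * F) (hg : dehom g = (C u * X - C t) * G) :
    firstPrincipalSubresultant f g d e =
      u ^ ((e - 1) + (d - 1)) * resultant G F (e - 1) (d - 1) := by
  set N := (e - 1) + (d - 1) with hN
  -- Coefficient k + 1 of (uX - t)H is u H_k - t H_{k+1}, so passing from H to these coefficients is
  -- the bidiagonal `T`, of determinant u^N.
  let T : Matrix (Fin N) (Fin N) R := Matrix.of fun k l =>
    if k = l then u else if (k : ℕ) = l + 1 then -t else 0
  have hT : T.det = u ^ N := by
    rw [Matrix.det_of_isLowerTriangular T]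
    · simp [T]
    · intro i j hij
      have hij' : i < j := by simpa using hij
      have h1 : i ≠ j := hij'.ne
      have h2 : (i : ℕ) ≠ j + 1 := by
        have := Fin.lt_def.mp hij'
        omega
      simp [T, h1, h2]
  have key : ∀ (H : R[X]) (k : Fin N), H.natDegree < N →
      ((C u * X - C t) * H).coeff ((k : ℕ) + 1) = ∑ l : Fin N, H.coeff l * T l k := by
    intro H k hH
    have h1 : ((C u * X - C t) * H).coeff ((k : ℕ) + 1) =
        H.coeff k * u - H.coeff (k + 1) * t := by
      rw [sub_mul, mul_assoc, coeff_sub, coeff_C_mul, coeff_C_mul, coeff_X_mul]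
      ring
    rw [h1]
    by_cases hk : (k : ℕ) + 1 < N
    · have hne : k ≠ (⟨k + 1, hk⟩ : Fin N) := by
        intro h
        have := congrArg Fin.val h
        simp at this
      rw [← Finset.sum_subset (Finset.subset_univ ({k, ⟨k + 1, hk⟩} : Finset (Fin N)))]
      · rw [Finset.sum_pair hne]
        simp [T, hne.symm]
        ring
      · intro l _ hl
        simp only [Finset.mem_insert, Finset.mem_singleton, not_or, Fin.ext_iff] at hl
        simp [T, Fin.ext_iff, hl.1, hl.2]
    · rw [Finset.sum_eq_single k]
      · rw [coeff_eq_zero_of_natDegree_lt (n := (k : ℕ) + 1) (by omega)]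
        simp [T]
      · intro l _ hl
        have : (l : ℕ) ≠ k + 1 := by omega
        simp [T, hl, this]
      · simp
  -- The first block of columns of `sylvester G F` holds the shifts of `F`, whence the order of the
  -- arguments.
  have hprod : (Matrix.of fun (i k : Fin N) =>
      Fin.addCases
        (fun i₁ : Fin (e - 1) => (X ^ (i₁ : ℕ) * dehom f).coeff ((k : ℕ) + 1))
        (fun i₂ : Fin (d - 1) => (X ^ (i₂ : ℕ) * dehom g).coeff ((k : ℕ) + 1)) i) =
      (sylvester G F (e - 1) (d - 1)).transpose * T := by
    have hs : ∀ (H : R[X]) (j m l : ℕ), H.natDegree ≤ m →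
        (if l ∈ Set.Icc j (j + m) then H.coeff (l - j) else 0) = (X ^ j * H).coeff l := by
      intro H j m l hH
      rw [coeff_X_pow_mul']
      by_cases h1 : j ≤ l
      · by_cases h2 : l ≤ j + m
        · simp [h1, h2]
        · rw [coeff_eq_zero_of_natDegree_lt (p := H) (by omega)]
          simp
      · simp [h1]
    ext i k
    rw [Matrix.mul_apply]
    induction i using Fin.addCases with
    | left i =>
      have hdeg : (X ^ (i : ℕ) * F).natDegree < N :=
        lt_of_le_of_lt (natDegree_mul_le_of_le (natDegree_X_pow_le _) hF) (by omega)
      simp only [Matrix.of_apply, Fin.addCases_left, Matrix.transpose_apply, sylvester, hf]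
      rw [mul_left_comm, key _ _ hdeg]
      exact Finset.sum_congr rfl fun l _ => by rw [hs _ _ _ _ hF]
    | right i =>
      have hdeg : (X ^ (i : ℕ) * G).natDegree < N :=
        lt_of_le_of_lt (natDegree_mul_le_of_le (natDegree_X_pow_le _) hG) (by omega)
      simp only [Matrix.of_apply, Fin.addCases_right, Matrix.transpose_apply, sylvester, hg]
      rw [mul_left_comm, key _ _ hdeg]
      exact Finset.sum_congr rfl fun l _ => by rw [hs _ _ _ _ hG]
  rw [firstPrincipalSubresultant, hprod, Matrix.det_mul, Matrix.det_transpose, hT, resultant,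
    mul_comm]

end Resultant

/-! ### Dehomogenization, and factors of forms -/

section Forms

variable {R : Type*} [CommRing R]

theorem dehom_add (f g : BinPoly R) : dehom (f + g) = dehom f + dehom g := map_add _ _ _

theorem dehom_sub (f g : BinPoly R) : dehom (f - g) = dehom f - dehom g := map_sub _ _ _

theorem dehom_mul (f g : BinPoly R) : dehom (f * g) = dehom f * dehom g := map_mul _ _ _

theorem dehom_sum {ι : Type*} (s : Finset ι) (f : ι → BinPoly R) :
    dehom (∑ i ∈ s, f i) = ∑ i ∈ s, dehom (f i) := map_sum _ _ _

theorem dehom_zero : dehom (0 : BinPoly R) = 0 := map_zero _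

theorem dehom_C (r : R) : dehom (MvPolynomial.C r) = C r := by
  simp [dehom]

theorem dehom_map {S : Type*} [CommRing S] (φ : R →+* S) (f : BinPoly R) :
    dehom (MvPolynomial.map φ f) = (dehom f).map φ := by
  induction f using MvPolynomial.induction_on with
  | C a => simp [dehom_C]
  | add p q hp hq => simp [dehom_add, hp, hq]
  | mul_X p i hp =>
    rw [map_mul, dehom_mul, hp, MvPolynomial.map_X, dehom_mul, Polynomial.map_mul]
    congr 1
    fin_cases i <;> simp [dehom]

theorem natDegree_dehom_le {f : BinPoly R} {d : ℕ} (hf : f.IsHomogeneous d) :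
    (dehom f).natDegree ≤ d := by
  have := MvPolynomial.aeval_natDegree_le f hf.totalDegree_le ![(X : R[X]), 1] (n := 1)
    (fun i => by fin_cases i <;> simp [natDegree_X_le])
  simpa [dehom] using this

theorem homogenize_dehom {f : BinPoly R} {d : ℕ} (hf : f.IsHomogeneous d) :
    (dehom f).homogenize d = f :=
  homogenize_eq_of_isHomogeneous hf rfl

theorem dehom_homogenize {f : R[X]} {d : ℕ} (hf : f.natDegree ≤ d) :
    dehom (f.homogenize d) = f :=
  aeval_homogenize_X_one f hf

theorem dehom_eq_zero_iff {f : BinPoly R} {d : ℕ} (hf : f.IsHomogeneous d) :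
    dehom f = 0 ↔ f = 0 := by
  refine ⟨fun h => ?_, fun h => by rw [h, dehom_zero]⟩
  rw [← homogenize_dehom hf, h, homogenize_zero]

/-- The homomorphism that marks the homogeneous components of a polynomial by the powers of a new
variable. -/
noncomputable def gradingHom (σ R : Type*) [CommRing R] :
    MvPolynomial σ R →ₐ[R] (MvPolynomial σ R)[X] :=
  MvPolynomial.aeval fun i => C (MvPolynomial.X i) * X

theorem gradingHom_monomial {σ : Type*} (d : σ →₀ ℕ) (r : R) :
    gradingHom σ R (MvPolynomial.monomial d r) =
      C (MvPolynomial.monomial d r) * X ^ d.degree := by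
  rw [gradingHom, MvPolynomial.aeval_monomial, MvPolynomial.monomial_eq, map_mul, mul_assoc]
  congr 1
  simp only [Finsupp.prod, mul_pow, Finset.prod_mul_distrib, Finset.prod_pow_eq_pow_sum,
    Finsupp.degree_apply, map_prod, map_pow]

theorem coeff_gradingHom {σ : Type*} (p : MvPolynomial σ R) (k : ℕ) :
    (gradingHom σ R p).coeff k = MvPolynomial.homogeneousComponent k p := by
  induction p using MvPolynomial.induction_on' with
  | monomial d r =>
    rw [gradingHom_monomial, coeff_C_mul, coeff_X_pow]
    split_ifs with hk
    · rw [mul_one, MvPolynomial.homogeneousComponent_eq_self]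
      exact MvPolynomial.isHomogeneous_monomial _ hk.symm
    · rw [mul_zero, MvPolynomial.homogeneousComponent_of_mem
        (MvPolynomial.isHomogeneous_monomial r rfl), if_neg hk]
  | add p q hp hq => rw [map_add, coeff_add, hp, hq, map_add]

theorem gradingHom_of_isHomogeneous {σ : Type*} {p : MvPolynomial σ R} {n : ℕ}
    (h : p.IsHomogeneous n) : gradingHom σ R p = C p * X ^ n := by
  ext1 k
  rw [coeff_gradingHom, coeff_C_mul, coeff_X_pow, MvPolynomial.homogeneousComponent_of_mem h]
  split_ifs <;> simp

/-- Under `gradingHom` a form becomes a monomial in the new variable. Degree and trailing degree are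
additive and agree for the product, hence agree for each factor. -/
theorem isHomogeneous_of_mul [IsDomain R] {σ : Type*} {f g : MvPolynomial σ R} {n : ℕ}
    (h : (f * g).IsHomogeneous n) (hfg : f * g ≠ 0) : f.IsHomogeneous f.totalDegree := by
  have hT := gradingHom_of_isHomogeneous h
  rw [map_mul] at hT
  have hne : gradingHom σ R f * gradingHom σ R g ≠ 0 := by
    rw [hT]
    exact mul_ne_zero (C_ne_zero.mpr hfg) (pow_ne_zero _ X_ne_zero)
  have h1 := natDegree_mul (left_ne_zero_of_mul hne) (right_ne_zero_of_mul hne)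
  have h2 := natTrailingDegree_mul (left_ne_zero_of_mul hne) (right_ne_zero_of_mul hne)
  rw [hT, C_mul_X_pow_eq_monomial] at h1 h2
  rw [natDegree_monomial_eq _ hfg] at h1
  rw [natTrailingDegree_monomial hfg] at h2
  have h4 := natTrailingDegree_le_natDegree (gradingHom σ R f)
  have h5 := natTrailingDegree_le_natDegree (gradingHom σ R g)
  have hz : ∀ k, k ≠ (gradingHom σ R f).natDegree →
      MvPolynomial.homogeneousComponent k f = 0 := by
    intro k hk
    rw [← coeff_gradingHom]
    rcases lt_or_gt_of_ne hk with hk | hk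
    · exact coeff_eq_zero_of_lt_natTrailingDegree (by omega)
    · exact coeff_eq_zero_of_natDegree_lt hk
  have h6 : f = MvPolynomial.homogeneousComponent (gradingHom σ R f).natDegree f := by
    conv_lhs => rw [← MvPolynomial.sum_homogeneousComponent f]
    refine Finset.sum_eq_single _ (fun k _ hk => hz k hk) fun hk => ?_
    apply MvPolynomial.homogeneousComponent_eq_zero
    simpa using hk
  have h7 : f.IsHomogeneous (gradingHom σ R f).natDegree := by
    rw [h6]
    convert! MvPolynomial.homogeneousComponent_isHomogeneous _ _
    exact h6.symm
  rwa [h7.totalDegree (left_ne_zero_of_mul hfg)]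

theorem isHomogeneous_of_mul_left [IsDomain R] {σ : Type*} {f g : MvPolynomial σ R} {m n : ℕ}
    (hf : f.IsHomogeneous m) (hf0 : f ≠ 0) (h : (f * g).IsHomogeneous (m + n)) :
    g.IsHomogeneous n := by
  by_cases hg : g = 0
  · rw [hg]
    exact MvPolynomial.isHomogeneous_zero _ _ _
  have h0 := mul_ne_zero hf0 hg
  have h1 := isHomogeneous_of_mul (mul_comm f g ▸ h) (mul_comm f g ▸ h0)
  have h2 := (hf.mul h1).inj_right h h0
  rwa [Nat.add_left_cancel h2] at h1

end Forms

/-! ### Divisibility by su - tv, and values at (t:u) -/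

section Diagonal

variable {K : Type*} [Field K]

/-- The linear polynomial `u X - t`, that is, `s u - t v` with `s = X`, `v = 1`. -/
noncomputable def diagonalPoly (K : Type*) [Field K] : (BinPoly K)[X] :=
  C (MvPolynomial.X 1) * X - C (MvPolynomial.X 0)

theorem dehom_diagonalForm : dehom (diagonalForm K) = diagonalPoly K := by
  rw [diagonalForm, dehom_sub, dehom_mul, dehom_mul, dehom_C, dehom_C, diagonalPoly, mul_comm]
  simp [dehom]

theorem natDegree_diagonalPoly : (diagonalPoly K).natDegree = 1 := by
  rw [diagonalPoly, sub_eq_add_neg, ← C_neg]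
  exact natDegree_linear (MvPolynomial.X_ne_zero _)

theorem diagonalPoly_ne_zero : diagonalPoly K ≠ 0 := by
  intro h
  have := natDegree_diagonalPoly (K := K)
  simp [h] at this

/-- The coefficients u and -t are coprime. By Gauss's lemma, divisibility by L can then be tested at
its root t/u over the fraction field. -/
theorem isPrimitive_diagonalPoly : (diagonalPoly K).IsPrimitive := by
  intro r hr
  rw [C_dvd_iff_dvd_coeff] at hr
  have h0 := hr 0
  have h1 := hr 1
  simp only [diagonalPoly, coeff_sub, coeff_C_mul, coeff_X_zero, coeff_X_one, coeff_C_zero,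
    mul_zero, zero_sub, dvd_neg, mul_one, coeff_C_succ, sub_zero] at h0 h1
  obtain ⟨a, ha⟩ := h1
  rcases (MvPolynomial.X_prime (R := K)).irreducible.isUnit_or_isUnit ha with h | h
  · exact h
  · exfalso
    have h2 := h.mul_right_dvd.mpr h0
    rw [← ha, MvPolynomial.X_dvd_X] at h2
    exact absurd h2 (by decide)

theorem aeval_diagonal {f : BinPoly K} {d : ℕ} (hf : f.IsHomogeneous d) :
    algebraMap (BinPoly K) (FractionRing (BinPoly K)) f =
      eval (algebraMap (BinPoly K) (FractionRing (BinPoly K)) (MvPolynomial.X 0) /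
          algebraMap (BinPoly K) (FractionRing (BinPoly K)) (MvPolynomial.X 1))
        (((dehom f).map MvPolynomial.C).map (algebraMap (BinPoly K) (FractionRing (BinPoly K)))) *
        algebraMap (BinPoly K) (FractionRing (BinPoly K)) (MvPolynomial.X 1) ^ d := by
  have hu : algebraMap (BinPoly K) (FractionRing (BinPoly K)) (MvPolynomial.X 1) ≠ 0 := by
    simp [MvPolynomial.X_ne_zero]
  have h := eval_homogenize (p := ((dehom f).map MvPolynomial.C).map
    (algebraMap (BinPoly K) (FractionRing (BinPoly K)))) (n := d)
    ((natDegree_map_le.trans natDegree_map_le).trans (natDegree_dehom_le hf))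
    (fun i => algebraMap (BinPoly K) (FractionRing (BinPoly K)) (MvPolynomial.X i)) hu
  rw [← h, homogenize_map, homogenize_map, homogenize_dehom hf, MvPolynomial.eval_map,
    MvPolynomial.eval₂_map]
  conv_lhs => rw [← MvPolynomial.eval₂_eta f]
  rw [MvPolynomial.eval₂_comp_left]
  rfl

theorem map_diagonalPoly : (diagonalPoly K).map (algebraMap (BinPoly K) (FractionRing (BinPoly K))) =
    C (algebraMap (BinPoly K) (FractionRing (BinPoly K)) (MvPolynomial.X 1)) *
      (X - C (algebraMap (BinPoly K) (FractionRing (BinPoly K)) (MvPolynomial.X 0) /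
          algebraMap (BinPoly K) (FractionRing (BinPoly K)) (MvPolynomial.X 1))) := by
  have hu : algebraMap (BinPoly K) (FractionRing (BinPoly K)) (MvPolynomial.X 1) ≠ 0 := by
    simp [MvPolynomial.X_ne_zero]
  rw [mul_sub, ← C_mul, mul_div_cancel₀ _ hu]
  simp [diagonalPoly]

theorem resultant_diagonalPoly {f : BinPoly K} {d : ℕ} (hf : f.IsHomogeneous d) :
    resultant ((dehom f).map MvPolynomial.C) (diagonalPoly K) d 1 = (-1) ^ d * f := by
  apply IsFractionRing.injective (BinPoly K) (FractionRing (BinPoly K))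
  rw [← resultant_map_map, map_diagonalPoly, resultant_C_mul_right, ← pow_one (X - C _),
    resultant_X_sub_C_pow_right _ _ _ _
      ((natDegree_map_le.trans natDegree_map_le).trans (natDegree_dehom_le hf)),
    map_mul, aeval_diagonal hf]
  simp
  ring

theorem diagonalPoly_dvd_of_eval {g : (BinPoly K)[X]}
    (hg : eval (algebraMap (BinPoly K) (FractionRing (BinPoly K)) (MvPolynomial.X 0) /
          algebraMap (BinPoly K) (FractionRing (BinPoly K)) (MvPolynomial.X 1))
        (g.map (algebraMap (BinPoly K) (FractionRing (BinPoly K)))) = 0) : diagonalPoly K ∣ g := by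
  have hu : algebraMap (BinPoly K) (FractionRing (BinPoly K)) (MvPolynomial.X 1) ≠ 0 := by
    simp [MvPolynomial.X_ne_zero]
  refine isPrimitive_diagonalPoly.dvd_of_fraction_map_dvd_fraction_map
    (K := FractionRing (BinPoly K)) ?_
  rw [map_diagonalPoly]
  exact (IsUnit.mul_left_dvd (isUnit_C.mpr hu.isUnit)).mpr (dvd_iff_isRoot.mpr hg)

/-- The value `∑ φ_i(t, u) p_i(X, 1)` of the moving line `p` at the point `φ(t, u)`. -/
noncomputable def movingLineAt (φ p : Fin 3 → BinPoly K) : (BinPoly K)[X] :=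
  ∑ i, C (φ i) * (dehom (p i)).map MvPolynomial.C

theorem natDegree_movingLineAt_le {φ p : Fin 3 → BinPoly K} {d : ℕ}
    (hp : ∀ i, (p i).IsHomogeneous d) : (movingLineAt φ p).natDegree ≤ d :=
  natDegree_sum_le_of_forall_le _ _ fun i _ =>
    (natDegree_C_mul_le _ _).trans (natDegree_map_le.trans (natDegree_dehom_le (hp i)))

/-- The value of the moving line at X = t/u, times u^d, is the syzygy itself. -/
theorem diagonalPoly_dvd_movingLineAt {φ p : Fin 3 → BinPoly K} {d : ℕ}
    (hp : ∀ i, (p i).IsHomogeneous d) (h : ∑ i, p i * φ i = 0) :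
    diagonalPoly K ∣ movingLineAt φ p := by
  have hu : algebraMap (BinPoly K) (FractionRing (BinPoly K)) (MvPolynomial.X 1) ≠ 0 := by
    simp [MvPolynomial.X_ne_zero]
  apply diagonalPoly_dvd_of_eval
  apply mul_right_cancel₀ (pow_ne_zero d hu)
  have h1 := congrArg (algebraMap (BinPoly K) (FractionRing (BinPoly K))) h
  rw [map_sum, map_zero] at h1
  rw [movingLineAt, Polynomial.map_sum, eval_finsetSum, Finset.sum_mul, zero_mul, ← h1]
  refine Finset.sum_congr rfl fun i _ => ?_
  rw [map_mul, aeval_diagonal (hp i), Polynomial.map_mul, eval_mul, map_C, eval_C]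
  ring

end Diagonal

/-! ### Coprime forms and pencils -/

section Coprime

variable {K : Type*} [Field K]

theorem eq_zero_of_isUnit {f : BinPoly K} {d : ℕ} (hf : f.IsHomogeneous d) (h : IsUnit f) :
    d = 0 := by
  obtain ⟨r, hr, rfl⟩ := MvPolynomial.isUnit_iff_eq_C_of_isReduced.mp h
  exact hf.inj_right (MvPolynomial.isHomogeneous_C _ _) (by simpa using hr.ne_zero)

theorem homogenize_dvd_of_dvd_dehom {f : BinPoly K} {d : ℕ} (hf : f.IsHomogeneous d) {r : K[X]}
    (hr : r ∣ dehom f) : r.homogenize r.natDegree ∣ f := by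
  by_cases hf0 : f = 0
  · simp [hf0]
  obtain ⟨s, hs⟩ := hr
  have h0 : r * s ≠ 0 := by
    rw [← hs]
    exact fun h => hf0 ((dehom_eq_zero_iff hf).mp h)
  have h1 := natDegree_mul (left_ne_zero_of_mul h0) (right_ne_zero_of_mul h0)
  have h2 := natDegree_dehom_le hf
  rw [hs] at h2
  refine ⟨s.homogenize (d - r.natDegree), ?_⟩
  rw [← homogenize_mul _ _ le_rfl (by omega), ← hs, show r.natDegree + (d - r.natDegree) = d by omega,
    homogenize_dehom hf]

/-- Vanishing at the point at infinity shows as a drop of degree. -/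
theorem X_one_dvd_iff {f : BinPoly K} {d : ℕ} (hf : f.IsHomogeneous (d + 1)) :
    MvPolynomial.X 1 ∣ f ↔ (dehom f).natDegree ≤ d := by
  constructor
  · rintro ⟨g, rfl⟩
    have hg : g.IsHomogeneous d := isHomogeneous_of_mul_left (m := 1)
      (MvPolynomial.isHomogeneous_X _ _) (MvPolynomial.X_ne_zero _) (by rwa [add_comm])
    have : dehom (MvPolynomial.X 1 * g) = dehom g := by
      rw [dehom_mul]
      simp [dehom]
    rw [this]
    exact natDegree_dehom_le hg
  · intro h
    refine ⟨(dehom f).homogenize d, ?_⟩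
    have := homogenize_mul (dehom f) 1 h (n := 1) (by simp)
    rw [mul_one, homogenize_dehom hf, homogenize_one, pow_one] at this
    rw [mul_comm, ← this]

theorem isCoprime_dehom {f g : BinPoly K} {d e : ℕ} (hf : f.IsHomogeneous d)
    (hg : g.IsHomogeneous e) (hf0 : f ≠ 0) (h : IsRelPrime f g) :
    IsCoprime (dehom f) (dehom g) := by
  refine IsRelPrime.isCoprime fun r hrf hrg => ?_
  have h1 := eq_zero_of_isUnit (isHomogeneous_homogenize r)
    (h (homogenize_dvd_of_dvd_dehom hf hrf) (homogenize_dvd_of_dvd_dehom hg hrg))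
  have h2 : r ≠ 0 := by
    rintro rfl
    exact hf0 ((dehom_eq_zero_iff hf).mp (zero_dvd_iff.mp hrf))
  rw [eq_C_of_natDegree_eq_zero h1] at h2 ⊢
  exact isUnit_C.mpr (Ne.isUnit (by simpa using h2))

/-- The resultant of two coprime forms does not vanish. -/
theorem resultant_dehom_ne_zero {f g : BinPoly K} {d e : ℕ} (hf : f.IsHomogeneous d)
    (hg : g.IsHomogeneous e) (hf0 : f ≠ 0) (h : IsRelPrime f g) :
    resultant (dehom f) (dehom g) d e ≠ 0 := by
  have hf1 : dehom f ≠ 0 := fun h => hf0 ((dehom_eq_zero_iff hf).mp h)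
  have hfd := natDegree_dehom_le hf
  have hge := natDegree_dehom_le hg
  have hres := resultant_ne_zero _ _ (isCoprime_dehom hf hg hf0 h)
  -- The degrees cannot both drop, as `X 1` would divide both forms. A drop in one costs only a sign
  -- and a power of the leading coefficient of the other.
  by_cases hd : (dehom f).natDegree = d
  · obtain ⟨k, hk⟩ := Nat.exists_eq_add_of_le hge
    rw [hk, resultant_add_right_deg _ _ _ _ _ le_rfl, ← hd]
    exact mul_ne_zero (pow_ne_zero _ (leadingCoeff_ne_zero.mpr hf1)) hres
  · obtain ⟨k, rfl⟩ : ∃ k, d = k + 1 := ⟨d - 1, by omega⟩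
    have hXf : MvPolynomial.X 1 ∣ f := (X_one_dvd_iff hf).mpr (by omega)
    have hg0 : g ≠ 0 := by
      rintro rfl
      have := eq_zero_of_isUnit hf (h dvd_rfl (dvd_zero f))
      omega
    have hg1 : dehom g ≠ 0 := fun h => hg0 ((dehom_eq_zero_iff hg).mp h)
    have he : (dehom g).natDegree = e := by
      by_contra he
      obtain ⟨l, rfl⟩ : ∃ l, e = l + 1 := ⟨e - 1, by omega⟩
      exact MvPolynomial.X_prime.not_isUnit (h hXf ((X_one_dvd_iff hg).mpr (by omega)))
    obtain ⟨l, hl⟩ := Nat.exists_eq_add_of_le hfd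
    rw [hl, resultant_add_left_deg _ _ _ _ _ le_rfl, ← he]
    exact mul_ne_zero (mul_ne_zero (pow_ne_zero _ (by simp))
      (pow_ne_zero _ (leadingCoeff_ne_zero.mpr hg1))) hres

/-- A common factor has constant dehomogenization, so it is a constant times a power of `X 1`; as
`n` is the larger degree, `X 1` does not divide both forms. -/
theorem isRelPrime_homogenize {A C : K[X]} (h : IsCoprime A C) {n : ℕ}
    (hn : n = max A.natDegree C.natDegree) :
    IsRelPrime (A.homogenize n) (C.homogenize n) := by
  have hA : A.natDegree ≤ n := hn ▸ le_max_left _ _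
  have hC : C.natDegree ≤ n := hn ▸ le_max_right _ _
  intro r hrA hrC
  have hr : r.IsHomogeneous r.totalDegree := by
    by_cases hA0 : A = 0
    · have hC0 : C ≠ 0 := by
        rintro rfl
        rw [hA0] at h
        exact not_isCoprime_zero_zero h
      obtain ⟨s, hs⟩ := hrC
      have h0 : C.homogenize n ≠ 0 := fun h0 => hC0 (eq_zero_of_homogenize_eq_zero hC h0)
      exact isHomogeneous_of_mul (hs ▸ isHomogeneous_homogenize C) (hs ▸ h0)
    · obtain ⟨s, hs⟩ := hrA
      have h0 : A.homogenize n ≠ 0 := fun h0 => hA0 (eq_zero_of_homogenize_eq_zero hA h0)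
      exact isHomogeneous_of_mul (hs ▸ isHomogeneous_homogenize A) (hs ▸ h0)
  have hd : ∀ {f : BinPoly K}, r ∣ f → dehom r ∣ dehom f := by
    rintro f ⟨s, rfl⟩
    exact ⟨_, dehom_mul _ _⟩
  have hu := h.isRelPrime (dehom_homogenize hA ▸ hd hrA) (dehom_homogenize hC ▸ hd hrC)
  obtain ⟨a, ha, hra⟩ := Polynomial.isUnit_iff.mp hu
  have hr2 := homogenize_dehom hr
  rw [← hra, homogenize_C] at hr2
  rcases Nat.eq_zero_or_pos r.totalDegree with h0 | h0
  · rw [h0, pow_zero, mul_one] at hr2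
    rw [← hr2]
    exact ha.map MvPolynomial.C
  · exfalso
    have hX : MvPolynomial.X 1 ∣ r := by
      rw [← hr2]
      exact Dvd.dvd.mul_left (dvd_pow_self _ h0.ne') _
    have hn0 : n ≠ 0 := by
      rintro rfl
      obtain ⟨a, rfl⟩ := natDegree_eq_zero.mp (Nat.le_zero.mp hA)
      obtain ⟨c, rfl⟩ := natDegree_eq_zero.mp (Nat.le_zero.mp hC)
      simp only [homogenize_C, pow_zero, mul_one] at hrA hrC
      have : a ≠ 0 ∨ c ≠ 0 := by
        by_contra! hac
        rw [hac.1, hac.2, map_zero] at h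
        exact not_isCoprime_zero_zero h
      have hru : IsUnit r := by
        rcases this with h1 | h1
        · exact isUnit_of_dvd_unit hrA (h1.isUnit.map MvPolynomial.C)
        · exact isUnit_of_dvd_unit hrC (h1.isUnit.map MvPolynomial.C)
      exact h0.ne' (eq_zero_of_isUnit hr hru)
    obtain ⟨m, rfl⟩ := Nat.exists_eq_succ_of_ne_zero hn0
    have h1 := (X_one_dvd_iff (isHomogeneous_homogenize A)).mp (hX.trans hrA)
    have h2 := (X_one_dvd_iff (isHomogeneous_homogenize C)).mp (hX.trans hrC)
    rw [dehom_homogenize hA] at h1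
    rw [dehom_homogenize hC] at h2
    omega

theorem C_eval_mul_sub_ne_zero {A C : K[X]} (h : IsCoprime A C)
    (hn : 1 ≤ max A.natDegree C.natDegree) (x : K) :
    Polynomial.C (eval x A) * C - A * Polynomial.C (eval x C) ≠ 0 := by
  intro h0
  rw [sub_eq_zero] at h0
  have hx : eval x A ≠ 0 ∨ eval x C ≠ 0 := by
    by_contra! hac
    obtain ⟨a, b, hab⟩ := h
    have := congrArg (eval x) hab
    simp [hac.1, hac.2] at this
  have hunit : ∀ {p : K[X]}, IsUnit p → p.natDegree = 0 := fun h =>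
    natDegree_eq_zero_of_isUnit h
  rcases hx with h1 | h1
  · have hAC : A ∣ C := by
      refine (IsUnit.dvd_mul_left (isUnit_C.mpr h1.isUnit)).mp ?_
      exact h0 ▸ dvd_mul_right _ _
    obtain ⟨a, rfl⟩ := natDegree_eq_zero.mp (hunit (h.isUnit_of_dvd' dvd_rfl hAC))
    have := congrArg natDegree h0
    rw [natDegree_C_mul h1, ← C_mul, natDegree_C] at this
    rw [natDegree_C] at hn
    omega
  · have hCA : C ∣ A := by
      refine (IsUnit.dvd_mul_right (isUnit_C.mpr h1.isUnit)).mp ?_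
      exact h0 ▸ dvd_mul_left _ _
    obtain ⟨c, rfl⟩ := natDegree_eq_zero.mp (hunit (h.isUnit_of_dvd' hCA dvd_rfl))
    have := congrArg natDegree h0
    rw [← C_mul, natDegree_C, natDegree_mul_C h1] at this
    rw [natDegree_C] at hn
    omega

/-- For all but finitely many `x`, the member `C(x) A - A(x) C` of the pencil spanned by two
coprime forms `A, C` is coprime to a given form. -/
theorem exists_isRelPrime_pencil [Infinite K] {f : BinPoly K} (hf : f ≠ 0) {A C : K[X]}
    (h : IsCoprime A C) {n : ℕ} (hn : n = max A.natDegree C.natDegree) (hn1 : 1 ≤ n) :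
    ∃ x : K, IsRelPrime f (MvPolynomial.C (eval x C) * A.homogenize n -
      MvPolynomial.C (eval x A) * C.homogenize n) := by
  classical
  -- Two non-proportional members of the pencil span both generators, so a prime divides at most one
  -- member up to proportionality. Once it divides the member at x, every other bad y is a zero of
  -- A(x)C - A C(x).
  have hbad : ∀ r : BinPoly K, Prime r → ∃ w : K[X], w ≠ 0 ∧ ∀ x,
      r ∣ (MvPolynomial.C (eval x C) * A.homogenize n -
        MvPolynomial.C (eval x A) * C.homogenize n) → eval x w = 0 := by
    intro r hr
    by_cases hex : ∃ x, r ∣ (MvPolynomial.C (eval x C) * A.homogenize n -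
        MvPolynomial.C (eval x A) * C.homogenize n)
    · obtain ⟨x, hx⟩ := hex
      refine ⟨_, C_eval_mul_sub_ne_zero h (hn ▸ hn1) x, fun y hy => ?_⟩
      by_contra hne
      have hu : IsUnit (MvPolynomial.C (eval x A * eval y C - eval y A * eval x C) : BinPoly K) := by
        refine IsUnit.map MvPolynomial.C (Ne.isUnit ?_)
        simpa using hne
      have hA : r ∣ A.homogenize n := by
        refine hu.dvd_mul_left.mp ?_
        convert dvd_sub (hy.mul_left (MvPolynomial.C (eval x A)))
          (hx.mul_left (MvPolynomial.C (eval y A))) using 1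
        simp only [map_sub, map_mul]
        ring
      have hC : r ∣ C.homogenize n := by
        refine hu.dvd_mul_left.mp ?_
        convert dvd_sub (hy.mul_left (MvPolynomial.C (eval x C)))
          (hx.mul_left (MvPolynomial.C (eval y C))) using 1
        simp only [map_sub, map_mul]
        ring
      exact hr.not_isUnit (isRelPrime_homogenize h hn hA hC)
    · push Not at hex
      exact ⟨1, one_ne_zero, fun x hx => absurd hx (hex x)⟩
  choose! w hw0 hw using hbad
  let s := (UniqueFactorizationMonoid.factors f).toFinset
  have hs : ∀ r ∈ s, Prime r := fun r hr =>
    UniqueFactorizationMonoid.prime_of_factor r (Multiset.mem_toFinset.mp hr)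
  have hW : ∏ r ∈ s, w r ≠ 0 := Finset.prod_ne_zero_iff.mpr fun r hr => hw0 r (hs r hr)
  obtain ⟨x, hx⟩ : ∃ x, eval x (∏ r ∈ s, w r) ≠ 0 := by
    by_contra! hall
    exact hW (Polynomial.funext fun x => by rw [hall x, eval_zero])
  refine ⟨x, (UniqueFactorizationMonoid.isRelPrime_iff_no_prime_factors hf).mpr ?_⟩
  intro r hrf hrg hr
  obtain ⟨r', hr', hass⟩ :=
    UniqueFactorizationMonoid.exists_mem_factors_of_dvd hf hr.irreducible hrf
  have hmem : r' ∈ s := Multiset.mem_toFinset.mpr hr'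
  apply hx
  rw [eval_prod]
  exact Finset.prod_eq_zero hmem (hw r' (hs r' hmem) x (hass.symm.dvd.trans hrg))

end Coprime

/-! ### The resultant identities linking brackets and moving lines -/

section Identities

variable {R : Type*} [CommRing R]

theorem resultant_mul_eq_of_modEq_right {F₁ F₂ P p₁ p₂ δ : R[X]} {x y : R}
    {m₁ m₂ e d a : ℕ} (hF₁ : F₁.natDegree ≤ m₁) (hF₂ : F₂.natDegree ≤ m₂) (hP : P.natDegree ≤ a)
    (hp₂ : p₂.natDegree ≤ e) (hδ : δ.natDegree ≤ d) (hdeg : e + m₂ = d + a)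
    (hp₁ : p₁ = 0 ∨ p₁.natDegree + m₁ ≤ d + a)
    (h : p₂ * (C y * F₂) = -(δ * P) - F₁ * (C x * p₁)) :
    resultant F₁ p₂ m₁ e * (y ^ m₁ * resultant F₁ F₂ m₁ m₂) =
      (-1) ^ m₁ * (resultant F₁ δ m₁ d * resultant F₁ P m₁ a) := by
  rw [← resultant_C_mul_right, ← resultant_mul_right_of_le _ _ _ hF₁ hp₂
    ((natDegree_C_mul_le _ _).trans hF₂), h, hdeg, ← resultant_mul_right_of_le _ _ _ hF₁ hδ hP,
    ← resultant_C_mul_right, ← resultant_add_mul_right_of_le F₁ (C (-1) * (δ * P)) (-(C x * p₁)) _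
      hF₁]
  · congr 1
    simp
    ring
  · rcases hp₁ with rfl | hp₁
    · simp
    · right
      rw [natDegree_neg]
      exact (Nat.add_le_add_right (natDegree_C_mul_le _ _) _).trans hp₁

theorem resultant_mul_eq_of_modEq_left {F P Q p q : R[X]} {x : R} {m a b e : ℕ}
    (hP : P.natDegree ≤ a) (hQ : Q.natDegree ≤ b) (hp : p.natDegree ≤ e) (hdeg : m = e + b)
    (hq : q = 0 ∨ q.natDegree + a ≤ m) (h : C x * F = p * Q - q * P) :
    x ^ a * resultant F P m a = resultant p P e a * resultant Q P b a := by
  rw [← resultant_C_mul_left, h, sub_eq_add_neg, ← neg_mul, mul_comm (-q),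
    resultant_add_mul_left_of_le _ _ _ _ hP, hdeg, resultant_mul_left_of_le _ _ _ hP hp hQ]
  simpa using hq

/-- The congruence modulo `f` is known only after multiplication by `L`, so Res(f, L) stays on both
sides until it is shown to be nonzero. -/
theorem resultant_mul_eq_of_linear_mul {f L P w z F k : R[X]} {x : R} {e a n m μ : ℕ}
    (hf : f.natDegree ≤ e) (hL : L.natDegree ≤ 1) (hP : P.natDegree ≤ a) (hw : w.natDegree ≤ n)
    (hz : z.natDegree ≤ μ) (hF : F.natDegree ≤ m) (hdeg : a + n = μ + m)
    (hk : k.natDegree + e ≤ 1 + (a + n))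
    (h : L * (P * w) = C x * (L * (z * F)) + f * k) :
    resultant f L e 1 * (resultant f P e a * resultant f w e n) =
      resultant f L e 1 * (x ^ e * (resultant f z e μ * resultant f F e m)) := by
  have h1 : (P * w).natDegree ≤ a + n := natDegree_mul_le_of_le hP hw
  have h2 : (z * F).natDegree ≤ μ + m := natDegree_mul_le_of_le hz hF
  rw [← resultant_mul_right_of_le _ _ _ hf hP hw, ← resultant_mul_right_of_le _ _ _ hf hL h1, h,
    resultant_add_mul_right _ _ _ _ _ hk hf, resultant_C_mul_right, hdeg,
    resultant_mul_right_of_le _ _ _ hf hL h2, resultant_mul_right_of_le _ _ _ hf hz hF]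
  ring

theorem resultant_linear_mul {f L F A k : R[X]} {x : R} {d m n : ℕ} (hf : f.natDegree ≤ d)
    (hL : L.natDegree ≤ 1) (hF : F.natDegree ≤ m) (hdeg : n = 1 + m) (hk : k.natDegree + d ≤ n)
    (h : L * F = C x * A + f * k) :
    resultant f L d 1 * resultant f F d m = x ^ d * resultant f A d n := by
  rw [← resultant_mul_right_of_le _ _ _ hf hL hF, h, ← hdeg,
    resultant_add_mul_right _ _ _ _ _ hk hf, resultant_C_mul_right]

/-- The comparison of the resultant of `F₁, F₂` with that of `P, Q`, up to factors that do not
involve them. -/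
theorem resultant_comparison [IsDomain R] {L F₁ F₂ P Q A B δ h q p₁ p₂ p₃ q₁ q₂ q₃ : R[X]}
    {κ hv qv δv Av Bv α β : R} {m₁ m₂ a b e dh dq dδ : ℕ}
    (hP : L * P = C (hv * Av) * (q * p₁) + C (qv * Bv) * (h * p₂) + C (hv * qv * δv) * p₃)
    (hQ : L * Q = C (hv * Av) * (q * q₁) + C (qv * Bv) * (h * q₂) + C (hv * qv * δv) * q₃)
    (hF₁ : L * F₁ = A * C (qv * δv) - C Av * (q * δ))
    (hF₂ : L * F₂ = B * C (hv * δv) - C Bv * (h * δ))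
    (r₁ : p₂ * q₃ - p₃ * q₂ = C κ * A) (r₂ : p₃ * q₁ - p₁ * q₃ = C κ * B)
    (r₃ : p₁ * q₂ - p₂ * q₁ = C κ * δ) (hsyz : p₁ * A + p₂ * B + p₃ * δ = 0)
    (hL0 : L ≠ 0) (hκ : κ ≠ 0) (hL : L.natDegree ≤ 1)
    (dF₁ : F₁.natDegree ≤ m₁) (dF₂ : F₂.natDegree ≤ m₂) (dP : P.natDegree ≤ a)
    (dQ : Q.natDegree ≤ b) (dA : A.natDegree ≤ dq + dδ) (dB : B.natDegree ≤ dh + dδ)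
    (ddh : h.natDegree ≤ dh) (ddq : q.natDegree ≤ dq) (ddδ : δ.natDegree ≤ dδ)
    (dp₁ : p₁ = 0 ∨ p₁.natDegree + dq ≤ a + 1) (dp₂ : p₂.natDegree ≤ e)
    (dp₃ : p₃.natDegree ≤ a + 1) (dq₂ : q₂ = 0 ∨ q₂.natDegree + dh ≤ b + 1)
    (hm₁ : m₁ + 1 = dq + dδ) (hm₂ : m₂ + 1 = dh + dδ) (he : e + dh = a + 1)
    (hab : (a + 1) + (b + 1) = dh + dq + dδ)
    (hnL : resultant p₂ L e 1 ≠ 0) (hnF : resultant p₂ F₁ e m₁ ≠ 0) :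
    ∃ j : ℕ, resultant F₁ F₂ m₁ m₂ * qv ^ m₁ * (κ * hv) ^ a *
        resultant p₂ (C α * A + C β * (q * δ)) e (dq + dδ) * resultant δ L dδ 1 =
      (-1) ^ j * (hv ^ e * resultant p₂ (C α * p₃ - C β * (q * p₁)) e (a + 1) *
        (qv * δv) ^ dδ * resultant δ A dδ (dq + dδ) * resultant Q P b a) := by
  -- In p₂·LQ - q₂·LP the terms with `Bv` cancel, and `r₁`, `r₃` turn the rest into κ hv L F₁.
  have hI : C (κ * hv) * F₁ = p₂ * Q - q₂ * P := by
    apply mul_left_cancel₀ hL0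
    simp only [map_mul] at hP hQ hF₁ ⊢
    linear_combination C κ * C hv * hF₁ - p₂ * hQ + q₂ * hP - C hv * C qv * C δv * r₁
      + C hv * C Av * q * r₃
  have hII : C (κ * qv) * F₂ = q₁ * P - p₁ * Q := by
    apply mul_left_cancel₀ hL0
    simp only [map_mul] at hP hQ hF₂ ⊢
    linear_combination C κ * C qv * hF₂ - q₁ * hP + p₁ * hQ - C hv * C qv * C δv * r₂
      + C qv * C Bv * h * r₃
  -- Eliminating `Q` between the two previous identities leaves the minor of `r₃` as coefficient of
  -- `P`.
  have hIII : p₂ * (C qv * F₂) = -(δ * P) - F₁ * (C hv * p₁) := by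
    apply mul_left_cancel₀ (C_ne_zero.mpr hκ)
    simp only [map_mul] at hI hII
    linear_combination p₂ * hII + p₁ * hI - P * r₃
  have E₁ := resultant_mul_eq_of_modEq_right dF₁ dF₂ dP dp₂ ddδ (by omega)
    (dp₁.imp_right fun _ => by omega) hIII
  have E₂ := resultant_mul_eq_of_modEq_left (m := m₁) dP dQ dp₂ (by omega)
    (dq₂.imp_right fun _ => by omega) hI
  -- Modulo `p₂` the syzygy reads p₁A = -p₃δ, so (p₃, -q p₁) is proportional to (A, qδ). Either of
  -- A, qδ may share a factor with `p₂`; a combination with free α, β avoids this.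
  have hIV : L * (P * (C α * A + C β * (q * δ))) =
      C hv * (L * ((C α * p₃ - C β * (q * p₁)) * F₁)) +
        p₂ * (C (qv * Bv) * (h * (C α * A + C β * (q * δ))) - C (α * (hv * Av)) * (q * B) -
          C (β * (hv * qv * δv)) * (q * B)) := by
    simp only [map_mul] at hP hF₁ ⊢
    linear_combination (C α * A + C β * (q * δ)) * hP -
      C hv * (C α * p₃ - C β * (q * p₁)) * hF₁ +
      (C α * C hv * C Av * q + C β * C hv * C qv * C δv * q) * hsyz
  have dw : (C α * A + C β * (q * δ)).natDegree ≤ dq + dδ :=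
    natDegree_add_le_of_degree_le ((natDegree_C_mul_le _ _).trans dA)
      ((natDegree_C_mul_le _ _).trans (natDegree_mul_le_of_le ddq ddδ))
  have dz : (C α * p₃ - C β * (q * p₁)).natDegree ≤ a + 1 := by
    refine (natDegree_sub_le_of_le ((natDegree_C_mul_le _ _).trans dp₃)
      ((natDegree_C_mul_le _ _).trans ?_)).trans (max_self _).le
    rcases dp₁ with rfl | dp₁
    · simp
    · exact (natDegree_mul_le_of_le ddq le_rfl).trans (by omega)
  have dk : (C (qv * Bv) * (h * (C α * A + C β * (q * δ))) - C (α * (hv * Av)) * (q * B) -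
      C (β * (hv * qv * δv)) * (q * B)).natDegree ≤ dh + dq + dδ := by
    have h1 : (q * B).natDegree ≤ dh + dq + dδ :=
      (natDegree_mul_le_of_le ddq dB).trans (by omega)
    refine (natDegree_sub_le_of_le (natDegree_sub_le_of_le
      ((natDegree_C_mul_le _ _).trans (natDegree_mul_le_of_le ddh dw))
      ((natDegree_C_mul_le _ _).trans h1)) ((natDegree_C_mul_le _ _).trans h1)).trans ?_
    omega
  have E₃ := mul_left_cancel₀ hnL (resultant_mul_eq_of_linear_mul dp₂ hL dP dw dz dF₁ (by omega)
    (by omega) hIV)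
  have E₄ := resultant_linear_mul (x := qv * δv) (A := A) (k := -(C Av * q)) (n := dq + dδ)
    ddδ hL dF₁ (by omega)
    (by
      rw [natDegree_neg]
      exact Nat.add_le_add_right ((natDegree_C_mul_le _ _).trans ddq) _)
    (by rw [hF₁]; ring)
  -- The sign: `m₁` from `E₁`, the other two terms from interchanging the arguments of Res(F₁, δ)
  -- and Res(F₁, p₂).
  refine ⟨m₁ + m₁ * dδ + m₁ * e, ?_⟩
  have hcx := resultant_comm F₁ p₂ m₁ e
  have hcy := resultant_comm F₁ δ m₁ dδ
  have hx : resultant F₁ p₂ m₁ e ≠ 0 := by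
    rw [hcx]
    exact mul_ne_zero (pow_ne_zero _ (by simp)) hnF
  apply mul_left_cancel₀ hx
  have hsq : ((-1 : R) ^ (m₁ * e)) * (-1) ^ (m₁ * e) = 1 := by
    rw [← mul_pow]
    simp
  have hx' : resultant p₂ F₁ e m₁ = (-1) ^ (m₁ * e) * resultant F₁ p₂ m₁ e := by
    rw [hcx, ← mul_assoc, hsq, one_mul]
  rw [hx'] at E₃
  rw [hcy] at E₁
  rw [pow_add, pow_add]
  generalize resultant F₁ p₂ m₁ e = x at *
  generalize resultant F₁ F₂ m₁ m₂ = D at *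
  generalize resultant δ F₁ dδ m₁ = y at *
  generalize resultant F₁ P m₁ a = z at *
  generalize resultant p₂ P e a = w at *
  generalize resultant Q P b a = Δ at *
  generalize resultant δ L dδ 1 = l at *
  generalize resultant δ A dδ (dq + dδ) = ρA at *
  generalize resultant p₂ (C α * A + C β * (q * δ)) e (dq + dδ) = ρw at *
  generalize resultant p₂ (C α * p₃ - C β * (q * p₁)) e (a + 1) = ρz at *
  generalize (κ * hv) ^ a = s at *
  generalize (qv * δv) ^ dδ = g at *
  generalize qv ^ m₁ = qm at *
  generalize hv ^ e = hve at *
  generalize ((-1 : R) ^ m₁) = s1 at *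
  generalize ((-1 : R) ^ (m₁ * dδ)) = s2 at *
  generalize ((-1 : R) ^ (m₁ * e)) = s3 at *
  linear_combination s * ρw * l * E₁ + s1 * s2 * y * ρw * l * E₂ + s1 * s2 * y * l * Δ * E₃
    + s1 * s2 * hve * ρz * s3 * x * Δ * E₄

end Identities

/-! ### Comparison of the two resultants up to a nonzero constant -/

section Core

variable {K : Type*} [Field K]

/-- The polynomial `f(X, 1)` with its coefficients regarded as elements of `K[t, u]`. -/
noncomputable def dehomLift (K : Type*) [Field K] : BinPoly K →+* (BinPoly K)[X] :=
  (mapRingHom MvPolynomial.C).comp (MvPolynomial.aeval ![(X : K[X]), 1]).toRingHom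

theorem dehomLift_apply (f : BinPoly K) : dehomLift K f = (dehom f).map MvPolynomial.C := rfl

theorem dehomLift_C (r : K) : dehomLift K (MvPolynomial.C r) = C (MvPolynomial.C r) := by
  rw [dehomLift_apply, dehom_C, map_C]

theorem natDegree_dehomLift_le {f : BinPoly K} {d : ℕ} (hf : f.IsHomogeneous d) :
    (dehomLift K f).natDegree ≤ d :=
  natDegree_map_le.trans (natDegree_dehom_le hf)

theorem resultant_dehomLift (f g : BinPoly K) (d e : ℕ) :
    resultant (dehomLift K f) (dehomLift K g) d e =
      MvPolynomial.C (resultant (dehom f) (dehom g) d e) := by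
  rw [dehomLift_apply, dehomLift_apply, resultant_map_map]

theorem isHomogeneous_of_mul_or_eq_zero {f g : BinPoly K} {m n : ℕ} (hf : f.IsHomogeneous m)
    (hf0 : f ≠ 0) (h : (f * g).IsHomogeneous n) :
    g = 0 ∨ m ≤ n ∧ g.IsHomogeneous (n - m) := by
  by_cases hg : g = 0
  · exact Or.inl hg
  right
  have h0 := mul_ne_zero hf0 hg
  have h1 := isHomogeneous_of_mul (mul_comm f g ▸ h) (mul_comm f g ▸ h0)
  have h2 := (hf.mul h1).inj_right h h0
  refine ⟨by omega, ?_⟩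
  rwa [← h2, Nat.add_sub_cancel_left]

/-- At (t,u) = (x,1) the bracket specializes to the pencil member at x. -/
theorem resultant_bracket_ne_zero {f : BinPoly K} {e n : ℕ} {A C : K[X]} (hA : A.natDegree ≤ n)
    (hC : C.natDegree ≤ n) {x : K} (hf : f.IsHomogeneous e) (hf0 : f ≠ 0)
    (hx : IsRelPrime f (MvPolynomial.C (eval x C) * A.homogenize n -
      MvPolynomial.C (eval x A) * C.homogenize n)) :
    resultant (dehomLift K f) (dehomLift K (A.homogenize n) * Polynomial.C (C.homogenize n) -
      Polynomial.C (A.homogenize n) * dehomLift K (C.homogenize n)) e n ≠ 0 := by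
  have hhom : (MvPolynomial.C (eval x C) * A.homogenize n -
      MvPolynomial.C (eval x A) * C.homogenize n).IsHomogeneous n :=
    ((isHomogeneous_homogenize A).C_mul _).sub ((isHomogeneous_homogenize C).C_mul _)
  have h := resultant_dehom_ne_zero hf hhom hf0 hx
  let ev : BinPoly K →+* K := MvPolynomial.eval ![x, 1]
  have hev : ∀ g : K[X], g.natDegree ≤ n → ev (g.homogenize n) = eval x g := by
    intro g hg
    have := eval_homogenize hg ![x, 1] (by simp)
    simpa using this
  have hevC : ev.comp MvPolynomial.C = RingHom.id K := by
    ext r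
    simp [ev]
  have hmap : ∀ g : BinPoly K, (dehomLift K g).map ev = dehom g := by
    intro g
    rw [dehomLift_apply, Polynomial.map_map, hevC, Polynomial.map_id]
  intro h0
  apply h
  have h1 := congrArg ev h0
  rw [← resultant_map_map, map_zero, hmap, Polynomial.map_sub, Polynomial.map_mul,
    Polynomial.map_mul, hmap, hmap, Polynomial.map_C, Polynomial.map_C, hev _ hC, hev _ hA] at h1
  rw [dehom_sub, dehom_mul, dehom_mul, dehom_C, dehom_C]
  rwa [mul_comm (dehom (A.homogenize n))] at h1

variable [Infinite K]

/-- No order between μ and ν is imposed, so the two lines can be exchanged when `p₂ = 0`. Factors h,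
q, δ are left uncancelled to avoid exponents -1. -/
theorem exists_resultant_eq {A C B D : K[X]} (hAC : IsCoprime A C) {n₁ n₂ : ℕ}
    (hn₁ : n₁ = max A.natDegree C.natDegree)
    {h q δ p₁ p₂ p₃ q₁ q₂ q₃ : BinPoly K} {dh dq dδ μ ν : ℕ}
    (hh : h.IsHomogeneous dh) (hq : q.IsHomogeneous dq) (hδ : δ.IsHomogeneous dδ)
    (hh0 : h ≠ 0) (hq0 : q ≠ 0) (hδ0 : δ ≠ 0)
    (hC : C.homogenize n₁ = q * δ) (hD : D.homogenize n₂ = h * δ)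
    (hdn₁ : n₁ = dq + dδ) (hdn₂ : n₂ = dh + dδ) (h1n₁ : 1 ≤ n₁) (h1n₂ : 1 ≤ n₂)
    (hμ : 1 ≤ μ) (hν : 1 ≤ ν) (hμν : μ + ν = dh + dq + dδ)
    (hp₁ : (q * p₁).IsHomogeneous μ) (hp₂ : (h * p₂).IsHomogeneous μ) (hp₃ : p₃.IsHomogeneous μ)
    (hq₂ : (h * q₂).IsHomogeneous ν) (hp₂0 : p₂ ≠ 0)
    {κ : K} (hκ : κ ≠ 0)
    (r₁ : p₂ * q₃ - p₃ * q₂ = MvPolynomial.C κ * A.homogenize n₁)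
    (r₂ : p₃ * q₁ - p₁ * q₃ = MvPolynomial.C κ * B.homogenize n₂)
    (r₃ : p₁ * q₂ - p₂ * q₁ = MvPolynomial.C κ * δ)
    (hsyz : p₁ * A.homogenize n₁ + p₂ * B.homogenize n₂ + p₃ * δ = 0)
    (hprim : ∀ r, Prime r → r ∣ q * p₁ → r ∣ h * p₂ → r ∣ p₃ → False)
    {F₁ F₂ P Q : (BinPoly K)[X]}
    (hF₁ : diagonalPoly K * F₁ = dehomLift K (A.homogenize n₁) * Polynomial.C (C.homogenize n₁) -
      Polynomial.C (A.homogenize n₁) * dehomLift K (C.homogenize n₁))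
    (hF₂ : diagonalPoly K * F₂ = dehomLift K (B.homogenize n₂) * Polynomial.C (D.homogenize n₂) -
      Polynomial.C (B.homogenize n₂) * dehomLift K (D.homogenize n₂))
    (hP : diagonalPoly K * P = Polynomial.C (h * A.homogenize n₁) * dehomLift K (q * p₁) +
      Polynomial.C (q * B.homogenize n₂) * dehomLift K (h * p₂) +
      Polynomial.C (h * q * δ) * dehomLift K p₃)
    (hQ : diagonalPoly K * Q = Polynomial.C (h * A.homogenize n₁) * dehomLift K (q * q₁) +
      Polynomial.C (q * B.homogenize n₂) * dehomLift K (h * q₂) +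
      Polynomial.C (h * q * δ) * dehomLift K q₃)
    (dF₁ : F₁.natDegree ≤ n₁ - 1) (dF₂ : F₂.natDegree ≤ n₂ - 1) (dP : P.natDegree ≤ μ - 1)
    (dQ : Q.natDegree ≤ ν - 1) :
    ∃ γ : K, γ ≠ 0 ∧ h ^ dh * q ^ dq * δ * resultant F₁ F₂ (n₁ - 1) (n₂ - 1) =
      MvPolynomial.C γ * (δ ^ dδ * h * q * resultant Q P (ν - 1) (μ - 1)) := by
  obtain ⟨m₁, rfl⟩ : ∃ m, n₁ = m + 1 := ⟨n₁ - 1, by omega⟩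
  obtain ⟨m₂, rfl⟩ : ∃ m, n₂ = m + 1 := ⟨n₂ - 1, by omega⟩
  obtain ⟨a, rfl⟩ : ∃ m, μ = m + 1 := ⟨μ - 1, by omega⟩
  obtain ⟨b, rfl⟩ : ∃ m, ν = m + 1 := ⟨ν - 1, by omega⟩
  simp only [Nat.add_sub_cancel] at *
  have hAn : A.natDegree ≤ m₁ + 1 := hn₁ ▸ le_max_left _ _
  have hCn : C.natDegree ≤ m₁ + 1 := hn₁ ▸ le_max_right _ _
  obtain ⟨hle, hp₂'⟩ := (isHomogeneous_of_mul_or_eq_zero hh hh0 hp₂).resolve_left hp₂0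
  obtain ⟨e, he⟩ := Nat.exists_eq_add_of_le' hle
  rw [he, Nat.add_sub_cancel] at hp₂'
  -- This x fixes α = C(x), β = -A(x), which makes αA + βqδ coprime to `p₂`.
  obtain ⟨x, hx⟩ := exists_isRelPrime_pencil hp₂0 hAC hn₁ h1n₁
  have hbr := resultant_bracket_ne_zero hAn hCn hp₂' hp₂0 hx
  have dA := isHomogeneous_homogenize (n := m₁ + 1) A
  have dB := isHomogeneous_homogenize (n := m₂ + 1) B
  have hAδ : IsRelPrime δ (A.homogenize (m₁ + 1)) := by
    refine IsRelPrime.symm fun r hr1 hr2 => isRelPrime_homogenize hAC hn₁ hr1 ?_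
    rw [hC]
    exact hr2.mul_left q
  rw [hC] at hx hbr hF₁
  rw [hD] at hF₂
  have hF₁' : diagonalPoly K * F₁ = dehomLift K (A.homogenize (m₁ + 1)) * Polynomial.C (q * δ) -
      Polynomial.C (A.homogenize (m₁ + 1)) * (dehomLift K q * dehomLift K δ) := by
    rw [hF₁, map_mul (dehomLift K)]
  have hF₂' : diagonalPoly K * F₂ = dehomLift K (B.homogenize (m₂ + 1)) * Polynomial.C (h * δ) -
      Polynomial.C (B.homogenize (m₂ + 1)) * (dehomLift K h * dehomLift K δ) := by
    rw [hF₂, map_mul (dehomLift K)]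
  have lift_eq : ∀ {f g : BinPoly K}, f = g → dehomLift K f = dehomLift K g :=
    fun h => congrArg _ h
  have r₁' := lift_eq r₁
  have r₂' := lift_eq r₂
  have r₃' := lift_eq r₃
  have hsyz' := lift_eq hsyz
  simp only [map_add, map_sub, map_mul, map_zero, dehomLift_C] at r₁' r₂' r₃' hsyz'
  have hnLF : resultant (dehomLift K p₂) (diagonalPoly K) e 1 *
      resultant (dehomLift K p₂) F₁ e m₁ ≠ 0 := by
    rw [← resultant_mul_right_of_le _ _ _ (natDegree_dehomLift_le hp₂')
      natDegree_diagonalPoly.le dF₁, hF₁, add_comm 1 m₁]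
    exact hbr
  have deg_imp : ∀ {f g : BinPoly K} {d m : ℕ}, f.IsHomogeneous d → f ≠ 0 →
      (f * g).IsHomogeneous m → dehomLift K g = 0 ∨ (dehomLift K g).natDegree + d ≤ m := by
    intro f g d m hf hf0 hfg
    rcases isHomogeneous_of_mul_or_eq_zero hf hf0 hfg with rfl | ⟨h1, h2⟩
    · exact Or.inl (map_zero _)
    · have := natDegree_dehomLift_le h2
      right
      omega
  rw [map_mul (dehomLift K), map_mul (dehomLift K)] at hP hQ
  obtain ⟨j, hj⟩ := resultant_comparison (κ := MvPolynomial.C κ)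
    (α := MvPolynomial.C (eval x C)) (β := MvPolynomial.C (-eval x A)) hP hQ hF₁' hF₂' r₁' r₂' r₃'
    hsyz' diagonalPoly_ne_zero (by simpa using hκ) natDegree_diagonalPoly.le dF₁ dF₂ dP dQ
    (hdn₁ ▸ natDegree_dehomLift_le dA) (hdn₂ ▸ natDegree_dehomLift_le dB)
    (natDegree_dehomLift_le hh) (natDegree_dehomLift_le hq) (natDegree_dehomLift_le hδ)
    (deg_imp hq hq0 hp₁) (natDegree_dehomLift_le hp₂') (natDegree_dehomLift_le hp₃)
    (deg_imp hh hh0 hq₂) hdn₁ hdn₂ he.symm hμν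
    (left_ne_zero_of_mul hnLF) (right_ne_zero_of_mul hnLF)
  set w := MvPolynomial.C (eval x C) * A.homogenize (m₁ + 1) -
    MvPolynomial.C (eval x A) * (q * δ) with hw
  set z := MvPolynomial.C (eval x C) * p₃ + MvPolynomial.C (eval x A) * (q * p₁) with hz
  have hwl : Polynomial.C (MvPolynomial.C (eval x C)) * dehomLift K (A.homogenize (m₁ + 1)) +
      Polynomial.C (MvPolynomial.C (-eval x A)) * (dehomLift K q * dehomLift K δ) =
      dehomLift K w := by
    simp only [hw, map_sub, map_mul, dehomLift_C, map_neg]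
    ring
  have hzl : Polynomial.C (MvPolynomial.C (eval x C)) * dehomLift K p₃ -
      Polynomial.C (MvPolynomial.C (-eval x A)) * (dehomLift K q * dehomLift K p₁) =
      dehomLift K z := by
    simp only [hz, map_add, map_mul, dehomLift_C, map_neg]
    ring
  have hwhom : w.IsHomogeneous (dq + dδ) := by
    have h1 := hq.mul hδ
    rw [← hdn₁] at h1 ⊢
    exact (dA.C_mul _).sub (h1.C_mul _)
  have hzhom : z.IsHomogeneous (a + 1) := (hp₃.C_mul _).add (hp₁.C_mul _)
  -- A common prime of `p₂` and `z` divides w·(q p₁) and w·p₃ but not w, hence all three coordinates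
  -- of the line.
  have hzrel : IsRelPrime p₂ z := by
    refine (UniqueFactorizationMonoid.isRelPrime_iff_no_prime_factors hp₂0).mpr ?_
    intro r hrp hrz hr
    have hrw : ¬ r ∣ w := fun h => hr.not_isUnit (hx hrp h)
    have hsr : r ∣ p₁ * A.homogenize (m₁ + 1) + p₃ * δ := by
      have h1 : p₁ * A.homogenize (m₁ + 1) + p₃ * δ = -(p₂ * B.homogenize (m₂ + 1)) := by
        linear_combination hsyz
      rw [h1]
      exact (hrp.mul_right _).neg_right
    have h1 : r ∣ q * p₁ := by
      refine (hr.dvd_or_dvd (a := w) ?_).resolve_left hrw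
      have : w * (q * p₁) = (MvPolynomial.C (eval x C) * q) *
          (p₁ * A.homogenize (m₁ + 1) + p₃ * δ) - q * δ * z := by
        rw [hw, hz]
        ring
      rw [this]
      exact dvd_sub (hsr.mul_left _) (hrz.mul_left _)
    have h3 : r ∣ p₃ := by
      refine (hr.dvd_or_dvd (a := w) ?_).resolve_left hrw
      have : w * p₃ = A.homogenize (m₁ + 1) * z - (MvPolynomial.C (eval x A) * q) *
          (p₁ * A.homogenize (m₁ + 1) + p₃ * δ) := by
        rw [hw, hz]
        ring
      rw [this]
      exact dvd_sub (hrz.mul_left _) (hsr.mul_left _)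
    exact hprim r hr h1 (hrp.mul_left _) h3
  have hρw := resultant_dehom_ne_zero hp₂' hwhom hp₂0 hx
  have hρz := resultant_dehom_ne_zero hp₂' hzhom hp₂0 hzrel
  have hρA := resultant_dehom_ne_zero hδ dA hδ0 hAδ
  rw [hwl, hzl, resultant_dehomLift, resultant_dehomLift, ← hdn₁, resultant_dehomLift,
    dehomLift_apply δ, resultant_diagonalPoly hδ] at hj
  rw [← hdn₁] at hρw
  generalize resultant (dehom p₂) (dehom w) e (m₁ + 1) = ρw at *
  generalize resultant (dehom p₂) (dehom z) e (a + 1) = ρz at *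
  generalize resultant (dehom δ) (dehom (A.homogenize (m₁ + 1))) dδ (m₁ + 1) = ρA at *
  refine ⟨(-1) ^ j * (-1) ^ dδ * (ρz * ρA) / (κ ^ a * ρw), ?_, ?_⟩
  · refine div_ne_zero ?_ (mul_ne_zero (pow_ne_zero _ hκ) hρw)
    exact mul_ne_zero (mul_ne_zero (pow_ne_zero _ (by simp)) (pow_ne_zero _ (by simp)))
      (mul_ne_zero hρz hρA)
  · have hc : κ ^ a * ρw ≠ 0 := mul_ne_zero (pow_ne_zero _ hκ) hρw
    have hcC : MvPolynomial.C (σ := Fin 2) (κ ^ a * ρw) ≠ 0 := by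
      simpa only [ne_eq, MvPolynomial.C_eq_zero] using hc
    apply mul_left_cancel₀ hcC
    rw [← mul_assoc (MvPolynomial.C _) (MvPolynomial.C _), ← MvPolynomial.C_mul,
      mul_div_cancel₀ _ hc]
    -- These powers restore q^m₁ and h^a, since m₁ + 1 = dq + dδ and a + 1 = dh + e.
    apply mul_left_cancel₀ (mul_ne_zero (pow_ne_zero dδ hq0) (pow_ne_zero e hh0))
    have hsq : ((-1 : BinPoly K) ^ dδ) * (-1) ^ dδ = 1 := by
      rw [← mul_pow]
      simp
    have hqpow : q ^ m₁ * q = q ^ dq * q ^ dδ := by rw [← pow_succ, hdn₁, pow_add]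
    have hhpow : h ^ a * h = h ^ dh * h ^ e := by rw [← pow_succ, he, pow_add, mul_comm]
    simp only [map_mul, map_pow, map_neg, map_one, mul_pow] at hj ⊢
    generalize resultant F₁ F₂ m₁ m₂ = D' at *
    generalize resultant Q P b a = Δ at *
    generalize (-1 : BinPoly K) ^ j = s1 at *
    generalize (-1 : BinPoly K) ^ dδ = s2 at *
    generalize MvPolynomial.C (σ := Fin 2) κ ^ a = k at *
    generalize MvPolynomial.C (σ := Fin 2) ρw = c1 at *
    generalize MvPolynomial.C (σ := Fin 2) ρz = c2 at *
    generalize MvPolynomial.C (σ := Fin 2) ρA = c3 at *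
    generalize q ^ m₁ = x1 at *
    generalize q ^ dq = x2 at *
    generalize q ^ dδ = x3 at *
    generalize h ^ a = y1 at *
    generalize h ^ dh = y2 at *
    generalize h ^ e = y3 at *
    generalize δ ^ dδ = d at *
    linear_combination s2 * h * q * hj - s2 ^ 2 * k * c1 * δ * D' * h * y1 * hqpow
      - s2 ^ 2 * k * c1 * δ * D' * x2 * x3 * hhpow - k * c1 * x2 * x3 * y2 * y3 * δ * D' * hsq

end Core

/-! ### Consequences of properness -/

section Proper

variable {K : Type*} [Field K]

/-- The degree of K(t) over K(f) is the larger degree of the reduced numerator and denominator of f,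
which A and C are up to units. -/
theorem max_natDegree_eq_one {A C : K[X]} (hC : C ≠ 0) (h : IsCoprime A C)
    (htop : IntermediateField.adjoin K
      ({algebraMap K[X] (RatFunc K) A / algebraMap K[X] (RatFunc K) C} : Set (RatFunc K)) = ⊤) :
    max A.natDegree C.natDegree = 1 := by
  set f := algebraMap K[X] (RatFunc K) A / algebraMap K[X] (RatFunc K) C with hf
  have h1 := RatFunc.finrank_eq_max_natDegree f
  rw [htop, IntermediateField.finrank_top] at h1
  have hC0 : algebraMap K[X] (RatFunc K) C ≠ 0 := RatFunc.algebraMap_ne_zero hC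
  have hd0 : algebraMap K[X] (RatFunc K) f.denom ≠ 0 :=
    RatFunc.algebraMap_ne_zero f.denom_ne_zero
  have heq : A * f.denom = f.num * C := by
    apply RatFunc.algebraMap_injective K
    rw [map_mul, map_mul, ← div_eq_div_iff hC0 hd0, RatFunc.num_div_denom]
  have hcop := RatFunc.isCoprime_num_denom f
  have hA : Associated A f.num := associated_of_dvd_dvd
    (h.dvd_of_dvd_mul_right (heq ▸ dvd_mul_right _ _))
    (hcop.dvd_of_dvd_mul_right (heq ▸ dvd_mul_right _ _))
  have hC : Associated C f.denom := associated_of_dvd_dvd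
    (h.symm.dvd_of_dvd_mul_left (heq ▸ dvd_mul_left _ _))
    (hcop.symm.dvd_of_dvd_mul_left (heq ▸ dvd_mul_left _ _))
  rw [natDegree_eq_of_degree_eq (degree_eq_degree_of_associated hA),
    natDegree_eq_of_degree_eq (degree_eq_degree_of_associated hC), ← h1]

/-- The relation makes B/D an affine function of A/C, so A/C alone generates K(t). -/
theorem max_natDegree_eq_one_of_linear_relation {A C B D : K[X]} (hC : C ≠ 0) (hD : D ≠ 0)
    (hAC : IsCoprime A C) (hproper : IsProperParam A C B D) {x y z : K} (hy : y ≠ 0)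
    (h : Polynomial.C x * A * D + Polynomial.C y * B * C + Polynomial.C z * C * D = 0) :
    max A.natDegree C.natDegree = 1 := by
  apply max_natDegree_eq_one hC hAC
  rw [eq_top_iff, ← hproper, IntermediateField.adjoin_le_iff]
  have hC0 : algebraMap K[X] (RatFunc K) C ≠ 0 := RatFunc.algebraMap_ne_zero hC
  have hD0 : algebraMap K[X] (RatFunc K) D ≠ 0 := RatFunc.algebraMap_ne_zero hD
  have hmem := IntermediateField.mem_adjoin_simple_self K
    (algebraMap K[X] (RatFunc K) A / algebraMap K[X] (RatFunc K) C)
  rintro g (rfl | rfl)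
  · exact hmem
  · have h1 := congrArg (algebraMap K[X] (RatFunc K)) h
    simp only [map_add, map_mul, map_zero, RatFunc.algebraMap_C] at h1
    have hy0 : (RatFunc.C y : RatFunc K) ≠ 0 := by simpa using hy
    have h2 : algebraMap K[X] (RatFunc K) B / algebraMap K[X] (RatFunc K) D =
        algebraMap K (RatFunc K) (-x / y) *
          (algebraMap K[X] (RatFunc K) A / algebraMap K[X] (RatFunc K) C) +
        algebraMap K (RatFunc K) (-z / y) := by
      simp only [RatFunc.algebraMap_eq_C, map_div₀, map_neg]
      field_simp
      linear_combination h1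
    rw [h2]
    exact add_mem (mul_mem (IntermediateField.algebraMap_mem _ _) hmem)
      (IntermediateField.algebraMap_mem _ _)

theorem IsProperParam.symm {A C B D : K[X]} (h : IsProperParam A C B D) :
    IsProperParam B D A C := by
  rw [IsProperParam, Set.pair_comm]
  exact h

theorem max_natDegree_eq_one_of_max_natDegree_eq_zero {A C B D : K[X]} (hC : C ≠ 0) (hD : D ≠ 0)
    (hBD : IsCoprime B D) (hproper : IsProperParam A C B D)
    (h : max A.natDegree C.natDegree = 0) : max B.natDegree D.natDegree = 1 := by
  obtain ⟨a, rfl⟩ := natDegree_eq_zero.mp (Nat.max_eq_zero_iff.mp h).1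
  obtain ⟨c, rfl⟩ := natDegree_eq_zero.mp (Nat.max_eq_zero_iff.mp h).2
  have hc : c ≠ 0 := by simpa using hC
  refine max_natDegree_eq_one_of_linear_relation hD hC hBD hproper.symm (x := 0) (y := 1)
    (z := -a / c) one_ne_zero ?_
  have : (Polynomial.C (-a / c) * Polynomial.C c : K[X]) = -Polynomial.C a := by
    rw [← C_mul, div_mul_cancel₀ _ hc, C_neg]
  linear_combination D * this + D * Polynomial.C a * (C_1 (R := K)) +
    B * Polynomial.C c * (C_0 (R := K))

end Proper

/-! ### Common denominators, the Hilbert-Burch relation, primitivity of syzygies -/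

section Divisibility

variable {K : Type*} [Field K]

/-- Dividing c by a common factor of h and q leaves a common multiple. -/
theorem isRelPrime_of_isLcm {R : Type*} [CommRing R] [IsDomain R] {c x y h q : R}
    (hc : IsLcm c x y) (hc0 : c ≠ 0) (hh : c = h * x) (hq : c = q * y) : IsRelPrime h q := by
  rintro r ⟨h', rfl⟩ ⟨q', rfl⟩
  have hr : r ≠ 0 := by
    rintro rfl
    simp [hc0] at hh
  have he : h' * x = q' * y := by
    apply mul_left_cancel₀ hr
    rw [← mul_assoc, ← mul_assoc, ← hh, ← hq]
  obtain ⟨k, hk⟩ := hc.2.2 (h' * x) (dvd_mul_left _ _) (he ▸ dvd_mul_left _ _)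
  have he0 : h' * x ≠ 0 := by
    intro h0
    rw [mul_assoc, h0, mul_zero] at hh
    exact hc0 hh
  refine IsUnit.of_mul_eq_one k (mul_left_cancel₀ he0 ?_)
  rw [mul_one]
  conv_rhs => rw [hk, hh]
  ring

theorem associated_of_isGcd {R : Type*} [CommRing R] [IsDomain R] {d δ x y h q : R}
    (hd : IsGcd d x y) (hx : x = q * δ) (hy : y = h * δ) (hδ : δ ≠ 0) (hhq : IsRelPrime h q) :
    Associated δ d := by
  obtain ⟨k, rfl⟩ := hd.2.2 δ (hx ▸ dvd_mul_left _ _) (hy ▸ dvd_mul_left _ _)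
  have h1 : k ∣ q := by
    have := hd.1
    rw [hx, mul_comm q] at this
    exact (mul_dvd_mul_iff_left hδ).mp this
  have h2 : k ∣ h := by
    have := hd.2.1
    rw [hy, mul_comm h] at this
    exact (mul_dvd_mul_iff_left hδ).mp this
  exact (associated_mul_unit_right δ k (hhq h2 h1))

/-- A power `f ^ (d - 1)`, where `d` is the degree of `f` and the exponent `-1` is read as `0`. -/
theorem exists_pow_pred_mul {f : BinPoly K} {d : ℕ} (hf : f.IsHomogeneous d) (hf0 : f ≠ 0) :
    ∃ r : K, r ≠ 0 ∧ f ^ (d - 1) * f = MvPolynomial.C r * f ^ d := by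
  rcases d with _ | d
  · have h0 : f.totalDegree = 0 := Nat.le_zero.mp hf.totalDegree_le
    rw [MvPolynomial.totalDegree_eq_zero_iff_eq_C] at h0
    refine ⟨f.coeff 0, fun h => hf0 ?_, ?_⟩
    · rw [h0, h, map_zero]
    · simpa using h0
  · exact ⟨1, one_ne_zero, by simp [pow_succ]⟩

/-- The Hilbert-Burch relation: two independent syzygies whose degrees sum up to the degree of the
parameterization have it, up to a constant, as their cross product. -/
theorem exists_cross_eq {A B C D h q δ : BinPoly K} {p p' : Fin 3 → BinPoly K} {n μ ν : ℕ}
    (hC : C = q * δ) (hD : D = h * δ) (hAC : IsRelPrime A C) (hBD : IsRelPrime B D)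
    (hhq : IsRelPrime h q) (hc : (h * q * δ).IsHomogeneous n) (hc0 : h * q * δ ≠ 0)
    (hμν : μ + ν = n) (hp : ∀ i, (p i).IsHomogeneous μ) (hp' : ∀ i, (p' i).IsHomogeneous ν)
    (hind : LinearIndependent (BinPoly K) ![p, p'])
    (hsyz : p 0 * (h * A) + p 1 * (q * B) + p 2 * (h * q * δ) = 0)
    (hsyz' : p' 0 * (h * A) + p' 1 * (q * B) + p' 2 * (h * q * δ) = 0) :
    ∃ κ : K, κ ≠ 0 ∧ p 1 * p' 2 - p 2 * p' 1 = MvPolynomial.C κ * (h * A) ∧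
      p 2 * p' 0 - p 0 * p' 2 = MvPolynomial.C κ * (q * B) ∧
      p 0 * p' 1 - p 1 * p' 0 = MvPolynomial.C κ * (h * q * δ) := by
  have hδ0 : δ ≠ 0 := right_ne_zero_of_mul hc0
  have hh0 : h ≠ 0 := left_ne_zero_of_mul (left_ne_zero_of_mul hc0)
  have hq0 : q ≠ 0 := right_ne_zero_of_mul (left_ne_zero_of_mul hc0)
  have hC0 : C ≠ 0 := hC ▸ mul_ne_zero hq0 hδ0
  -- The cross product and (hA, qB, hqδ) are both orthogonal to the two syzygies, hence parallel.
  -- Coprimality makes the ratio `l` a polynomial, and μ + ν = n makes it a constant.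
  set w₀ := p 1 * p' 2 - p 2 * p' 1 with hw₀
  set w₁ := p 2 * p' 0 - p 0 * p' 2 with hw₁
  set w₂ := p 0 * p' 1 - p 1 * p' 0 with hw₂
  have h₁ : w₂ * A = w₀ * C := by
    apply mul_left_cancel₀ hh0
    rw [hw₂, hw₀, hC]
    linear_combination p' 1 * hsyz - p 1 * hsyz'
  have h₂ : w₂ * (q * B) = w₁ * (h * q * δ) := by
    rw [hw₂, hw₁]
    linear_combination p 0 * hsyz' - p' 0 * hsyz
  obtain ⟨k, hk⟩ : C ∣ w₂ := hAC.symm.dvd_of_dvd_mul_right (h₁ ▸ dvd_mul_left _ _)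
  have hk₀ : w₀ = A * k := by
    apply mul_left_cancel₀ hC0
    rw [mul_comm C, ← h₁, hk]
    ring
  have hk₁ : h * w₁ = k * (q * B) := by
    apply mul_left_cancel₀ hC0
    rw [← mul_assoc C k, ← hk, h₂, hC]
    ring
  have hhB : IsRelPrime h (q * B) := by
    refine hhq.mul_right (IsRelPrime.symm fun r hr1 hr2 => hBD hr1 ?_)
    rw [hD]
    exact hr2.mul_right δ
  obtain ⟨l, rfl⟩ : h ∣ k := hhB.dvd_of_dvd_mul_right (hk₁ ▸ dvd_mul_right _ _)
  have hl₁ : w₁ = l * (q * B) := by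
    apply mul_left_cancel₀ hh0
    rw [hk₁]
    ring
  have hl₂ : w₂ = h * q * δ * l := by
    rw [hk, hC]
    ring
  -- If all minors vanish, then p'_i p - p_i p' = 0 for each i, and independence forces p = 0.
  have hl0 : l ≠ 0 := by
    rintro rfl
    rw [LinearIndependent.pair_iff] at hind
    simp only [mul_zero, zero_mul] at hk₀ hl₁ hl₂
    have z₀ := hw₀.symm.trans hk₀
    have z₁ := hw₁.symm.trans hl₁
    have z₂ := hw₂.symm.trans hl₂
    have hzero : ∀ i, p i = 0 := by
      intro i
      have := (hind (p' i) (-p i) ?_).2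
      · simpa using this
      · funext j
        simp only [Pi.add_apply, Pi.smul_apply, smul_eq_mul, Pi.zero_apply]
        fin_cases i <;> fin_cases j <;> simp only [Fin.isValue, Fin.zero_eta, Fin.mk_one,
          Fin.reduceFinMk]
        · ring
        · linear_combination -z₂
        · linear_combination z₁
        · linear_combination z₂
        · ring
        · linear_combination -z₀
        · linear_combination -z₁
        · linear_combination z₀
        · ring
    have := (hind 1 0 (by
      rw [one_smul, zero_smul, add_zero]
      exact funext hzero)).1
    exact one_ne_zero this
  have hl : l.IsHomogeneous 0 := by
    refine isHomogeneous_of_mul_left hc hc0 ?_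
    rw [← hl₂, add_zero, ← hμν, hw₂]
    exact ((hp 0).mul (hp' 1)).sub ((hp 1).mul (hp' 0))
  have hlC : l = MvPolynomial.C (l.coeff 0) :=
    MvPolynomial.totalDegree_eq_zero_iff_eq_C.mp (Nat.le_zero.mp hl.totalDegree_le)
  refine ⟨l.coeff 0, fun h0 => hl0 (by rw [hlC, h0, map_zero]), ?_, ?_, ?_⟩
  · rw [← hlC, hk₀]
    ring
  · rw [← hlC, hl₁]
  · rw [← hlC, hl₂]
    ring

theorem IsMuBasis.mem_syzygies {φ : Fin 3 → BinPoly K} {n μ : ℕ} {p q : Fin 3 → BinPoly K}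
    (h : IsMuBasis φ n μ p q) : ∑ i, p i * φ i = 0 ∧ ∑ i, q i * φ i = 0 := by
  constructor
  · have : p ∈ syzygies φ := by
      rw [← h.span_eq]
      exact Submodule.subset_span (by simp)
    exact this
  · have : q ∈ syzygies φ := by
      rw [← h.span_eq]
      exact Submodule.subset_span (by simp)
    exact this

/-- The members of a μ-basis vanish nowhere. -/
theorem isUnit_of_dvd_of_span_eq {φ p q : Fin 3 → BinPoly K}
    (hind : LinearIndependent (BinPoly K) ![p, q])
    (hspan : Submodule.span (BinPoly K) {p, q} = syzygies φ) {r : BinPoly K} (hr0 : r ≠ 0)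
    (hr : ∀ i, r ∣ p i) : IsUnit r := by
  choose g hg using hr
  have hp : p ∈ syzygies φ := by
    rw [← hspan]
    exact Submodule.subset_span (by simp)
  -- The quotient p/r is again a syzygy, say ap + bq; independence in p = r(ap + bq) gives ra = 1.
  have hgs : g ∈ syzygies φ := by
    have h1 : ∑ i, p i * φ i = 0 := hp
    have h2 : r * ∑ i, g i * φ i = 0 := by
      rw [Finset.mul_sum, ← h1]
      exact Finset.sum_congr rfl fun i _ => by rw [hg i, mul_assoc]
    exact (mul_eq_zero.mp h2).resolve_left hr0
  rw [← hspan, Submodule.mem_span_pair] at hgs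
  obtain ⟨a, b, hab⟩ := hgs
  rw [LinearIndependent.pair_iff] at hind
  have := (hind (r * a - 1) (r * b) ?_).1
  · exact IsUnit.of_mul_eq_one a (sub_eq_zero.mp this)
  · funext i
    have h1 := congrFun hab i
    simp only [Pi.add_apply, Pi.smul_apply, smul_eq_mul, Pi.zero_apply] at h1 ⊢
    linear_combination r * h1 - hg i

end Divisibility

/-! ### Evaluation of the subresultant on the curve -/

section Assembly

theorem map_firstPrincipalSubresultant {R S : Type*} [CommRing R] [CommRing S] (ψ : R →+* S)
    (f g : BinPoly R) (d e : ℕ) :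
    ψ (firstPrincipalSubresultant f g d e) =
      firstPrincipalSubresultant (MvPolynomial.map ψ f) (MvPolynomial.map ψ g) d e := by
  rw [firstPrincipalSubresultant, firstPrincipalSubresultant, RingHom.map_det]
  congr 1
  ext i k
  induction i using Fin.addCases with
  | left i =>
    simp only [RingHom.mapMatrix_apply, Matrix.map_apply, Matrix.of_apply, Fin.addCases_left,
      dehom_map]
    rw [← coeff_map, Polynomial.map_mul, Polynomial.map_pow, map_X]
  | right i =>
    simp only [RingHom.mapMatrix_apply, Matrix.map_apply, Matrix.of_apply, Fin.addCases_right,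
      dehom_map]
    rw [← coeff_map, Polynomial.map_mul, Polynomial.map_pow, map_X]

theorem isHomogeneous_firstPrincipalSubresultant {R σ : Type*} [CommRing R]
    {f g : BinPoly (MvPolynomial σ R)} {n : ℕ} (hf : ∀ k, ((dehom f).coeff k).IsHomogeneous n)
    (hg : ∀ k, ((dehom g).coeff k).IsHomogeneous n) (d e : ℕ) :
    (firstPrincipalSubresultant f g d e).IsHomogeneous (((e - 1) + (d - 1)) * n) := by
  have hX : ∀ {P : (MvPolynomial σ R)[X]}, (∀ k, (P.coeff k).IsHomogeneous n) → ∀ i k,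
      ((X ^ i * P).coeff k).IsHomogeneous n := by
    intro P hP i k
    rw [coeff_X_pow_mul']
    split_ifs
    · exact hP _
    · exact MvPolynomial.isHomogeneous_zero _ _ _
  rw [firstPrincipalSubresultant, Matrix.det_apply]
  refine MvPolynomial.IsHomogeneous.sum _ _ _ fun s _ => ?_
  have hprod : (∏ i, (Matrix.of fun (i k : Fin ((e - 1) + (d - 1))) =>
      Fin.addCases (motive := fun _ => MvPolynomial σ R)
        (fun i₁ : Fin (e - 1) => (X ^ (i₁ : ℕ) * dehom f).coeff ((k : ℕ) + 1))
        (fun i₂ : Fin (d - 1) => (X ^ (i₂ : ℕ) * dehom g).coeff ((k : ℕ) + 1)) i)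
        (s i) i).IsHomogeneous (((e - 1) + (d - 1)) * n) := by
    have := MvPolynomial.IsHomogeneous.prod Finset.univ
      (fun i => (Matrix.of fun (i k : Fin ((e - 1) + (d - 1))) =>
      Fin.addCases (motive := fun _ => MvPolynomial σ R)
        (fun i₁ : Fin (e - 1) => (X ^ (i₁ : ℕ) * dehom f).coeff ((k : ℕ) + 1))
        (fun i₂ : Fin (d - 1) => (X ^ (i₂ : ℕ) * dehom g).coeff ((k : ℕ) + 1)) i)
        (s i) i) (fun _ => n) ?_
    · simpa using this
    · intro i _
      simp only [Matrix.of_apply]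
      induction s i using Fin.addCases with
      | left j =>
        rw [Fin.addCases_left]
        exact hX hf _ _
      | right j =>
        rw [Fin.addCases_right]
        exact hX hg _ _
  rcases Int.units_eq_one_or (Equiv.Perm.sign s) with h | h
  · rw [h, one_smul]
    exact hprod
  · rw [h, Units.neg_smul, one_smul]
    exact hprod.neg

variable {K : Type*} [Field K]

theorem dehom_map_movingLine (φ p : Fin 3 → BinPoly K) :
    dehom (MvPolynomial.map (MvPolynomial.aeval φ : MvPolynomial (Fin 3) K →ₐ[K] BinPoly K).toRingHom
      (movingLine p)) = movingLineAt φ p := by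
  rw [movingLine, movingLineAt, map_sum, dehom_sum]
  refine Finset.sum_congr rfl fun i _ => ?_
  rw [map_mul, dehom_mul, MvPolynomial.map_C, dehom_C, MvPolynomial.map_map, dehom_map]
  congr 1
  · simp
  · congr 1
    ext r
    simp

theorem coeff_movingLineAt_isHomogeneous {φ : Fin 3 → BinPoly K} {n : ℕ}
    (hφ : ∀ i, (φ i).IsHomogeneous n) (p : Fin 3 → BinPoly K) (k : ℕ) :
    ((movingLineAt φ p).coeff k).IsHomogeneous n := by
  rw [movingLineAt, finsetSum_coeff]
  refine MvPolynomial.IsHomogeneous.sum _ _ _ fun i _ => ?_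
  rw [coeff_C_mul, coeff_map]
  exact (hφ i).mul (MvPolynomial.isHomogeneous_C _ _)

theorem natDegree_le_of_diagonalPoly_mul {F G : (BinPoly K)[X]} {d : ℕ}
    (h : diagonalPoly K * F = G) (hG : G.natDegree ≤ d) : F.natDegree ≤ d - 1 := by
  by_cases hF : F = 0
  · simp [hF]
  · rw [← h, natDegree_mul diagonalPoly_ne_zero hF, natDegree_diagonalPoly] at hG
    omega

/-- The subresultant of a pair of independent moving lines at the points of the curve itself. -/
theorem isSubresultantForm_resultant {φ p q : Fin 3 → BinPoly K} {n μ : ℕ} {P Q : (BinPoly K)[X]}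
    (hφ : ∀ i, (φ i).IsHomogeneous n) (hμ : 1 ≤ μ) (hν : μ + 1 ≤ n)
    (hP : diagonalPoly K * P = movingLineAt φ p) (hQ : diagonalPoly K * Q = movingLineAt φ q)
    (dP : P.natDegree ≤ μ - 1) (dQ : Q.natDegree ≤ n - μ - 1) :
    IsSubresultantForm φ n μ p q (resultant Q P (n - μ - 1) (μ - 1)) := by
  set ψ := (MvPolynomial.aeval φ : MvPolynomial (Fin 3) K →ₐ[K] BinPoly K).toRingHom with hψ
  have hexp : (n - μ - 1) + (μ - 1) = n - 2 := by omega
  have heval : MvPolynomial.aeval φ (sRes p q μ (n - μ)) =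
      MvPolynomial.X 1 ^ (n - 2) * resultant Q P (n - μ - 1) (μ - 1) := by
    change ψ (firstPrincipalSubresultant _ _ _ _) = _
    rw [map_firstPrincipalSubresultant, ← hexp]
    refine firstPrincipalSubresultant_of_linear_mul (t := MvPolynomial.X 0) dP dQ ?_ ?_
    · rw [dehom_map_movingLine, ← hP, diagonalPoly]
    · rw [dehom_map_movingLine, ← hQ, diagonalPoly]
  refine ⟨?_, heval⟩
  have hhom : (MvPolynomial.aeval φ (sRes p q μ (n - μ))).IsHomogeneous ((n - 2) * n) := by
    rw [← hexp]
    change (ψ (firstPrincipalSubresultant _ _ _ _)).IsHomogeneous _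
    rw [map_firstPrincipalSubresultant]
    apply isHomogeneous_firstPrincipalSubresultant <;> intro k <;> rw [dehom_map_movingLine] <;>
      exact coeff_movingLineAt_isHomogeneous hφ _ _
  -- The determinant has order n - 2 and entries of degree n; removing u^(n-2) leaves degree (n -
  -- 1)(n - 2).
  refine isHomogeneous_of_mul_left (MvPolynomial.isHomogeneous_X_pow 1 (n - 2))
    (pow_ne_zero _ (MvPolynomial.X_ne_zero _)) (n := (n - 1) * (n - 2)) ?_
  rw [← heval]
  convert hhom using 1
  obtain ⟨m, rfl⟩ := Nat.exists_eq_add_of_le (show 2 ≤ n by omega)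
  rw [show 2 + m - 2 = m by omega, show 2 + m - 1 = m + 1 by omega]
  ring

theorem diagonalPoly_mul_dehom_bracketQuotient {f g : BinPoly K} {n : ℕ} (hf : f.IsHomogeneous n)
    (hg : g.IsHomogeneous n) :
    diagonalPoly K * dehom (bracketQuotient f g) =
      dehomLift K f * C g - C f * dehomLift K g := by
  rw [← dehom_diagonalForm, ← dehom_mul, diagonalForm_mul_bracketQuotient hf hg, bracket,
    dehom_sub, dehom_mul, dehom_mul, dehom_C, dehom_C, dehom_map, dehom_map, dehomLift_apply,
    dehomLift_apply]

theorem natDegree_dehom_bracketQuotient_le {f g : BinPoly K} {n : ℕ} (hf : f.IsHomogeneous n)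
    (hg : g.IsHomogeneous n) : (dehom (bracketQuotient f g)).natDegree ≤ n - 1 := by
  refine natDegree_le_of_diagonalPoly_mul (diagonalPoly_mul_dehom_bracketQuotient hf hg) ?_
  refine (natDegree_sub_le_of_le ((natDegree_mul_C_le _ _).trans (natDegree_dehomLift_le hf))
    ((natDegree_C_mul_le _ _).trans (natDegree_dehomLift_le hg))).trans (max_self _).le

end Assembly

/-! ### The factorization in terms of h, q, δ -/

section Main

variable {K : Type*} [Field K] [Infinite K]

/-- The factorization in terms of the cofactors `h, q` and the common part `δ` of the two
denominators `q δ` and `h δ`. -/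
theorem exists_dResultant_eq {A C B D : K[X]} (hAC : IsCoprime A C) (hBD : IsCoprime B D)
    (hC0 : C ≠ 0) (hD0 : D ≠ 0) (hproper : IsProperParam A C B D) {n₁ n₂ n : ℕ}
    (hn₁ : n₁ = max A.natDegree C.natDegree) (hn₂ : n₂ = max B.natDegree D.natDegree)
    {h q δ : BinPoly K} {dh dq dδ : ℕ} (hh : h.IsHomogeneous dh) (hq : q.IsHomogeneous dq)
    (hδ : δ.IsHomogeneous dδ) (hhq : IsRelPrime h q) (hc0 : h * q * δ ≠ 0)
    (hC : C.homogenize n₁ = q * δ) (hD : D.homogenize n₂ = h * δ)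
    (hn : n = dh + dq + dδ) (hn2 : 2 ≤ n) {μ : ℕ} {p p' : Fin 3 → BinPoly K}
    (hμ : IsMuBasis ![h * A.homogenize n₁, q * B.homogenize n₂, h * q * δ] n μ p p') :
    ∃ Δ : BinPoly K,
      IsSubresultantForm ![h * A.homogenize n₁, q * B.homogenize n₂, h * q * δ] n μ p p' Δ ∧
      ∃ γ : K, γ ≠ 0 ∧ h ^ dh * q ^ dq * δ *
          dResultant (A.homogenize n₁) (C.homogenize n₁) (B.homogenize n₂) (D.homogenize n₂)
            n₁ n₂ =
        MvPolynomial.C γ * (δ ^ dδ * h * q * Δ) := by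
  have hδ0 : δ ≠ 0 := right_ne_zero_of_mul hc0
  have hh0 : h ≠ 0 := left_ne_zero_of_mul (left_ne_zero_of_mul hc0)
  have hq0 : q ≠ 0 := right_ne_zero_of_mul (left_ne_zero_of_mul hc0)
  have hCn : C.natDegree ≤ n₁ := hn₁ ▸ le_max_right _ _
  have hDn : D.natDegree ≤ n₂ := hn₂ ▸ le_max_right _ _
  have dA := isHomogeneous_homogenize (n := n₁) A
  have dB := isHomogeneous_homogenize (n := n₂) B
  have dC := isHomogeneous_homogenize (n := n₁) C
  have dD := isHomogeneous_homogenize (n := n₂) D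
  have hdn₁ : n₁ = dq + dδ :=
    dC.inj_right (hC ▸ hq.mul hδ) (hC ▸ mul_ne_zero hq0 hδ0)
  have hdn₂ : n₂ = dh + dδ :=
    dD.inj_right (hD ▸ hh.mul hδ) (hD ▸ mul_ne_zero hh0 hδ0)
  have rAC := isRelPrime_homogenize hAC hn₁
  have rBD := isRelPrime_homogenize hBD hn₂
  -- If n₁ = dq + dδ = 0, then A/C is constant, so n₂ = 1 by properness and n = dh = 1.
  have h1n₁ : 1 ≤ n₁ := by
    by_contra h0
    have := max_natDegree_eq_one_of_max_natDegree_eq_zero hC0 hD0 hBD hproper (by omega)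
    omega
  have h1n₂ : 1 ≤ n₂ := by
    by_contra h0
    have := max_natDegree_eq_one_of_max_natDegree_eq_zero hD0 hC0 hAC hproper.symm (by omega)
    omega
  have hφ : ∀ i, (![h * A.homogenize n₁, q * B.homogenize n₂, h * q * δ] i).IsHomogeneous n := by
    intro i
    fin_cases i
    · have := hh.mul dA
      rwa [show dh + n₁ = n by omega] at this
    · have := hq.mul dB
      rwa [show dq + n₂ = n by omega] at this
    · have := (hh.mul hq).mul hδ
      rwa [← hn] at this
  have hμn := hμ.two_mul_le
  obtain ⟨hs, hs'⟩ := hμ.mem_syzygies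
  have hsum := hs
  have hsum' := hs'
  simp only [Fin.sum_univ_three, Fin.isValue, Matrix.cons_val_zero, Matrix.cons_val_one,
    Matrix.cons_val] at hs hs'
  obtain ⟨κ, hκ, c₀, c₁, c₂⟩ := exists_cross_eq hC hD rAC rBD hhq (hφ 2) hc0
    (show μ + (n - μ) = n by omega) hμ.homogeneous_p hμ.homogeneous_q hμ.linearIndependent hs hs'
  have hhB : IsRelPrime h (q * B.homogenize n₂) := by
    refine hhq.mul_right (IsRelPrime.symm fun r hr1 hr2 => rBD hr1 ?_)
    rw [hD]
    exact hr2.mul_right δ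
  have hqA : IsRelPrime q (h * A.homogenize n₁) := by
    refine hhq.symm.mul_right (IsRelPrime.symm fun r hr1 hr2 => rAC hr1 ?_)
    rw [hC]
    exact hr2.mul_right δ
  -- `h` divides the two other terms of the syzygy and is coprime to q B; likewise for `q` below.
  have dvd_one : ∀ x : Fin 3 → BinPoly K, x 0 * (h * A.homogenize n₁) +
      x 1 * (q * B.homogenize n₂) + x 2 * (h * q * δ) = 0 → h ∣ x 1 := by
    intro x hx
    refine hhB.dvd_of_dvd_mul_right ⟨-(x 0 * A.homogenize n₁ + x 2 * (q * δ)), ?_⟩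
    linear_combination hx
  have dvd_zero' : ∀ x : Fin 3 → BinPoly K, x 0 * (h * A.homogenize n₁) +
      x 1 * (q * B.homogenize n₂) + x 2 * (h * q * δ) = 0 → q ∣ x 0 := by
    intro x hx
    refine hqA.dvd_of_dvd_mul_right ⟨-(x 1 * B.homogenize n₂ + x 2 * (h * δ)), ?_⟩
    linear_combination hx
  obtain ⟨p₁, hp₁⟩ := dvd_zero' p hs
  obtain ⟨p₂, hp₂⟩ := dvd_one p hs
  obtain ⟨q₁, hq₁⟩ := dvd_zero' p' hs'
  obtain ⟨q₂, hq₂⟩ := dvd_one p' hs'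
  have syz : ∀ {x y z : BinPoly K}, q * x * (h * A.homogenize n₁) +
      h * y * (q * B.homogenize n₂) + z * (h * q * δ) = 0 →
      x * A.homogenize n₁ + y * B.homogenize n₂ + z * δ = 0 := by
    intro x y z hx
    apply mul_left_cancel₀ (mul_ne_zero hh0 hq0)
    linear_combination hx
  have hsyz : p₁ * A.homogenize n₁ + p₂ * B.homogenize n₂ + p 2 * δ = 0 := by
    rw [hp₁, hp₂] at hs
    exact syz hs
  have hsyz' : q₁ * A.homogenize n₁ + q₂ * B.homogenize n₂ + p' 2 * δ = 0 := by
    rw [hq₁, hq₂] at hs'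
    exact syz hs'
  have r₁ : p₂ * p' 2 - p 2 * q₂ = MvPolynomial.C κ * A.homogenize n₁ := by
    apply mul_left_cancel₀ hh0
    rw [hp₂, hq₂] at c₀
    linear_combination c₀
  have r₂ : p 2 * q₁ - p₁ * p' 2 = MvPolynomial.C κ * B.homogenize n₂ := by
    apply mul_left_cancel₀ hq0
    rw [hp₁, hq₁] at c₁
    linear_combination c₁
  have r₃ : p₁ * q₂ - p₂ * q₁ = MvPolynomial.C κ * δ := by
    apply mul_left_cancel₀ (mul_ne_zero hh0 hq0)
    rw [hp₁, hp₂, hq₁, hq₂] at c₂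
    linear_combination c₂
  have hκδ : MvPolynomial.C κ * δ ≠ 0 := mul_ne_zero (by simpa using hκ) hδ0
  have d₁ : (q * p₁).IsHomogeneous μ := hp₁ ▸ hμ.homogeneous_p 0
  have d₂ : (h * p₂).IsHomogeneous μ := hp₂ ▸ hμ.homogeneous_p 1
  have d₁' : (q * q₁).IsHomogeneous (n - μ) := hq₁ ▸ hμ.homogeneous_q 0
  have d₂' : (h * q₂).IsHomogeneous (n - μ) := hq₂ ▸ hμ.homogeneous_q 1
  -- A syzygy of degree 0 is a linear relation with constant coefficients: the curve is a line, and
  -- properness forces n = 1.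
  have h1μ : 1 ≤ μ := by
    by_contra h0
    have hμ0 : μ = 0 := by omega
    rw [hμ0] at d₁ d₂
    have h2 := hμ.homogeneous_p 2
    rw [hμ0] at h2
    have const : ∀ {f : BinPoly K}, f.IsHomogeneous 0 → ∃ r : K, f = MvPolynomial.C r :=
      fun hf => ⟨_, MvPolynomial.totalDegree_eq_zero_iff_eq_C.mp
        (Nat.le_zero.mp hf.totalDegree_le)⟩
    obtain ⟨x, hx⟩ := const d₁
    obtain ⟨y, hy⟩ := const d₂
    obtain ⟨z, hz⟩ := const h2
    have hrel : Polynomial.C x * A * D + Polynomial.C y * B * C + Polynomial.C z * C * D = 0 := by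
      have e : MvPolynomial.C x * A.homogenize n₁ * D.homogenize n₂ +
          MvPolynomial.C y * B.homogenize n₂ * C.homogenize n₁ +
          MvPolynomial.C z * C.homogenize n₁ * D.homogenize n₂ = 0 := by
        rw [hC, hD, ← hx, ← hy, ← hz]
        linear_combination h * q * δ * hsyz
      have e' := congrArg dehom e
      simpa only [dehom_add, dehom_mul, dehom_C, dehom_zero,
        dehom_homogenize (hn₁ ▸ le_max_left A.natDegree C.natDegree),
        dehom_homogenize (hn₂ ▸ le_max_left B.natDegree D.natDegree),
        dehom_homogenize hCn, dehom_homogenize hDn] using e'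
    by_cases hp₂0 : p₂ = 0
    · have hp₁0 : p₁ ≠ 0 := by
        rintro rfl
        rw [hp₂0, zero_mul, zero_mul, sub_zero] at r₃
        exact hκδ r₃.symm
      have hdq : dq = 0 := by
        have := ((isHomogeneous_of_mul_or_eq_zero hq hq0 d₁).resolve_left hp₁0).1
        omega
      have hx0 : x ≠ 0 := by
        rintro rfl
        rw [map_zero] at hx
        exact mul_ne_zero hq0 hp₁0 hx
      have := max_natDegree_eq_one_of_linear_relation hD0 hC0 hBD hproper.symm (x := y) (y := x)
        (z := z) hx0 (by linear_combination hrel)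
      omega
    · have hdh : dh = 0 := by
        have := ((isHomogeneous_of_mul_or_eq_zero hh hh0 d₂).resolve_left hp₂0).1
        omega
      have hy0 : y ≠ 0 := by
        rintro rfl
        rw [map_zero] at hy
        exact mul_ne_zero hh0 hp₂0 hy
      have := max_natDegree_eq_one_of_linear_relation hC0 hD0 hAC hproper hy0 hrel
      omega
  obtain ⟨P, hP⟩ := diagonalPoly_dvd_movingLineAt hμ.homogeneous_p hsum
  obtain ⟨Q, hQ⟩ := diagonalPoly_dvd_movingLineAt hμ.homogeneous_q hsum'
  have dP := natDegree_le_of_diagonalPoly_mul hP.symm (natDegree_movingLineAt_le hμ.homogeneous_p)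
  have dQ := natDegree_le_of_diagonalPoly_mul hQ.symm (natDegree_movingLineAt_le hμ.homogeneous_q)
  refine ⟨_, isSubresultantForm_resultant hφ h1μ (by omega) hP.symm hQ.symm dP dQ, ?_⟩
  have hP' : diagonalPoly K * P =
      Polynomial.C (h * A.homogenize n₁) * dehomLift K (q * p₁) +
      Polynomial.C (q * B.homogenize n₂) * dehomLift K (h * p₂) +
      Polynomial.C (h * q * δ) * dehomLift K (p 2) := by
    rw [← hP, ← hp₁, ← hp₂, movingLineAt, Fin.sum_univ_three]
    rfl
  have hQ' : diagonalPoly K * Q =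
      Polynomial.C (h * A.homogenize n₁) * dehomLift K (q * q₁) +
      Polynomial.C (q * B.homogenize n₂) * dehomLift K (h * q₂) +
      Polynomial.C (h * q * δ) * dehomLift K (p' 2) := by
    rw [← hQ, ← hq₁, ← hq₂, movingLineAt, Fin.sum_univ_three]
    rfl
  have hF₁ := diagonalPoly_mul_dehom_bracketQuotient dA dC
  have hF₂ := diagonalPoly_mul_dehom_bracketQuotient dB dD
  have dF₁ := natDegree_dehom_bracketQuotient_le dA dC
  have dF₂ := natDegree_dehom_bracketQuotient_le dB dD
  have prim : ∀ {x y : BinPoly K} {g g' : Fin 3 → BinPoly K}, g 0 = q * x → g 1 = h * y →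
      LinearIndependent (BinPoly K) ![g, g'] →
      Submodule.span (BinPoly K) {g, g'} =
        syzygies ![h * A.homogenize n₁, q * B.homogenize n₂, h * q * δ] →
      ∀ r, Prime r → r ∣ q * x → r ∣ h * y → r ∣ g 2 → False := by
    intro x y g g' hx hy hind hspan r hr h0 h1 h2
    refine hr.not_isUnit (isUnit_of_dvd_of_span_eq hind hspan hr.ne_zero fun i => ?_)
    fin_cases i
    · exact hx ▸ h0
    · exact hy ▸ h1
    · exact h2
  rw [dResultant, formResultant]
  -- By `r₃`, `p₂` and `q₂` do not both vanish. Exchanging the lines replaces κ by -κ and alters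
  -- Res(Q, P) by a sign.
  by_cases hp₂0 : p₂ = 0
  · have hq₂0 : q₂ ≠ 0 := by
      rintro rfl
      rw [hp₂0, zero_mul, mul_zero, sub_zero] at r₃
      exact hκδ r₃.symm
    obtain ⟨γ, hγ, hres⟩ := exists_resultant_eq (κ := -κ) (ν := μ) hAC hn₁ hh hq hδ hh0 hq0 hδ0
      hC hD hdn₁ hdn₂ h1n₁ h1n₂ (by omega) h1μ (by omega) d₁' d₂' (hμ.homogeneous_q 2) d₂ hq₂0
      (neg_ne_zero.mpr hκ)
      (by rw [map_neg]; linear_combination -r₁) (by rw [map_neg]; linear_combination -r₂)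
      (by rw [map_neg]; linear_combination -r₃) hsyz'
      (prim hq₁ hq₂ (LinearIndependent.pair_symm_iff.mp hμ.linearIndependent)
        (Set.pair_comm p p' ▸ hμ.span_eq)) hF₁ hF₂ hQ' hP' dF₁ dF₂ dQ dP
    refine ⟨γ * (-1) ^ ((μ - 1) * (n - μ - 1)), mul_ne_zero hγ (pow_ne_zero _ (by simp)), ?_⟩
    rw [hres, resultant_comm P Q]
    simp only [map_mul, map_pow, map_neg, map_one]
    ring
  · exact exists_resultant_eq hAC hn₁ hh hq hδ hh0 hq0 hδ0 hC hD hdn₁ hdn₂ h1n₁ h1n₂ h1μ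
      (by omega) (by omega) d₁ d₂ (hμ.homogeneous_p 2) d₂' hp₂0 hκ r₁ r₂ r₃ hsyz
      (prim hp₁ hp₂ hμ.linearIndependent hμ.span_eq) hF₁ hF₂ hP' hQ' dF₁ dF₂ dP dQ

end Main

end DResultant

/-! ### The theorem for arbitrary choices of lcm and gcd -/

theorem mainTheorem4 {K : Type*} [Field K] [CharZero K]
    (A C B D : K[X]) (hC : C ≠ 0) (hD : D ≠ 0)
    (hAC : IsCoprime A C) (hBD : IsCoprime B D)
    (hproper : DResultant.IsProperParam A C B D)
    (n₁ n₂ : ℕ) (hn₁ : n₁ = max A.natDegree C.natDegree)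
    (hn₂ : n₂ = max B.natDegree D.natDegree)
    -- the homogenizations of `A, C` to degree `n₁` and of `B, D` to degree `n₂`
    (A' C' B' D' : MvPolynomial (Fin 2) K)
    (hA' : A' = A.homogenize n₁) (hC' : C' = C.homogenize n₁)
    (hB' : B' = B.homogenize n₂) (hD' : D' = D.homogenize n₂)
    -- the common denominator `c = h C' = q D'` and `δ = gcd(C', D')`
    (c h q δ : MvPolynomial (Fin 2) K)
    (hc : DResultant.IsLcm c C' D') (hh : c = h * C') (hq : c = q * D')
    (hδ : DResultant.IsGcd δ C' D')
    -- the degree of the homogeneous parameterization `ν = (h A' : q B' : c)`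
    (n : ℕ) (hn : n = c.totalDegree) (hn2 : 2 ≤ n)
    -- a μ-basis of `ν`
    (μ : ℕ) (p₁ p₂ : Fin 3 → MvPolynomial (Fin 2) K)
    (hμ : DResultant.IsMuBasis ![h * A', q * B', c] n μ p₁ p₂) :
    ∃ Δ : MvPolynomial (Fin 2) K,
      DResultant.IsSubresultantForm ![h * A', q * B', c] n μ p₁ p₂ Δ ∧
      ∃ γ : K, γ ≠ 0 ∧
        h ^ (h.totalDegree - 1) * q ^ (q.totalDegree - 1) *
            DResultant.dResultant A' C' B' D' n₁ n₂ =
          MvPolynomial.C γ * (δ ^ (δ.totalDegree - 1) * Δ) := by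
  have hCn : C.natDegree ≤ n₁ := hn₁ ▸ le_max_right _ _
  have hDn : D.natDegree ≤ n₂ := hn₂ ▸ le_max_right _ _
  have dC : C'.IsHomogeneous n₁ := hC' ▸ isHomogeneous_homogenize C
  have dD : D'.IsHomogeneous n₂ := hD' ▸ isHomogeneous_homogenize D
  have hC0 : C' ≠ 0 := fun h0 => hC (eq_zero_of_homogenize_eq_zero hCn (hC' ▸ h0))
  have hD0 : D' ≠ 0 := fun h0 => hD (eq_zero_of_homogenize_eq_zero hDn (hD' ▸ h0))
  obtain ⟨k, hk⟩ := hc.2.2 (C' * D') (dvd_mul_right _ _) (dvd_mul_left _ _)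
  have hCD0 : C' * D' ≠ 0 := mul_ne_zero hC0 hD0
  have hc0 : c ≠ 0 := by
    rintro rfl
    rw [zero_mul] at hk
    exact hCD0 hk
  have hhq := DResultant.isRelPrime_of_isLcm hc hc0 hh hq
  -- δ₀ = D'/h = C'/q is the gcd adapted to h and q; the given δ is δ₀ times a constant r.
  obtain ⟨δ₀, hδD⟩ : h ∣ D' := hhq.dvd_of_dvd_mul_left (hq ▸ hh ▸ dvd_mul_right _ _)
  have hh0 : h ≠ 0 := by
    rintro rfl
    exact hc0 (by rw [hh, zero_mul])
  have hq0 : q ≠ 0 := by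
    rintro rfl
    exact hc0 (by rw [hq, zero_mul])
  have hδC : C' = q * δ₀ := by
    apply mul_left_cancel₀ hh0
    rw [← hh, hq, hδD]
    ring
  have hδ0 : δ₀ ≠ 0 := by
    rintro rfl
    exact hC0 (by rw [hδC, mul_zero])
  have hcδ : c = h * q * δ₀ := by rw [hh, hδC, mul_assoc]
  obtain ⟨u, hu⟩ := DResultant.associated_of_isGcd hδ hδC hδD hδ0 hhq
  obtain ⟨r, hr, hur⟩ := MvPolynomial.isUnit_iff_eq_C_of_isReduced.mp u.isUnit
  rw [hur] at hu
  have dc : c.IsHomogeneous c.totalDegree :=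
    DResultant.isHomogeneous_of_mul (hk ▸ dC.mul dD) (hk ▸ hCD0)
  have dh : h.IsHomogeneous h.totalDegree :=
    DResultant.isHomogeneous_of_mul (hh ▸ dc) (hh ▸ hc0)
  have dq : q.IsHomogeneous q.totalDegree :=
    DResultant.isHomogeneous_of_mul (hq ▸ dc) (hq ▸ hc0)
  have dδ : δ₀.IsHomogeneous δ₀.totalDegree :=
    DResultant.isHomogeneous_of_mul (g := q) (mul_comm q δ₀ ▸ hδC ▸ dC)
      (mul_comm q δ₀ ▸ hδC ▸ hC0)
  have hdeg : n = h.totalDegree + q.totalDegree + δ₀.totalDegree := by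
    rw [hn, hcδ, MvPolynomial.totalDegree_mul_of_isDomain (mul_ne_zero hh0 hq0) hδ0,
      MvPolynomial.totalDegree_mul_of_isDomain hh0 hq0]
  have hδdeg : δ.totalDegree = δ₀.totalDegree := by
    have h1 : δ.IsHomogeneous δ₀.totalDegree := by
      rw [← hu, mul_comm]
      exact dδ.C_mul r
    refine h1.totalDegree ?_
    rw [← hu]
    exact mul_ne_zero hδ0 (by simpa using hr.ne_zero)
  rw [hcδ] at hμ ⊢
  subst hA' hB'
  obtain ⟨Δ, hΔ, γ, hγ, hres⟩ := DResultant.exists_dResultant_eq hAC hBD hC hD hproper hn₁ hn₂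
    dh dq dδ hhq (hcδ ▸ hc0) (hC' ▸ hδC) (hD' ▸ hδD) hdeg hn2 hμ
  rw [← hC', ← hD'] at hres
  refine ⟨Δ, hΔ, ?_⟩
  -- x, y, z are 1 unless the form is constant, when they absorb the exponent -1 read as 0.
  obtain ⟨x, hx, hxh⟩ := DResultant.exists_pow_pred_mul dh hh0
  obtain ⟨y, hy, hyq⟩ := DResultant.exists_pow_pred_mul dq hq0
  obtain ⟨z, hz, hzδ⟩ := DResultant.exists_pow_pred_mul dδ hδ0
  have hden : z * r ^ (δ₀.totalDegree - 1) ≠ 0 := mul_ne_zero hz (pow_ne_zero _ hr.ne_zero)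
  refine ⟨x * y * γ / (z * r ^ (δ₀.totalDegree - 1)),
    div_ne_zero (mul_ne_zero (mul_ne_zero hx hy) hγ) hden, ?_⟩
  have hdenC : (MvPolynomial.C (z * r ^ (δ₀.totalDegree - 1)) : MvPolynomial (Fin 2) K) ≠ 0 := by
    simpa only [ne_eq, MvPolynomial.C_eq_zero] using hden
  apply mul_left_cancel₀ hdenC
  rw [← mul_assoc (MvPolynomial.C _) (MvPolynomial.C _), ← MvPolynomial.C_mul,
    mul_div_cancel₀ _ hden, hδdeg, ← hu]
  apply mul_left_cancel₀ (mul_ne_zero (mul_ne_zero hh0 hq0) hδ0)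
  simp only [map_mul, map_pow, mul_pow]
  generalize DResultant.dResultant (K := K) _ _ _ _ _ _ = E at *
  generalize (MvPolynomial.C r : MvPolynomial (Fin 2) K) ^ (δ₀.totalDegree - 1) = ρ at *
  generalize h ^ (h.totalDegree - 1) = h₁ at *
  generalize q ^ (q.totalDegree - 1) = q₁ at *
  generalize δ₀ ^ (δ₀.totalDegree - 1) = δ₁ at *
  generalize h ^ h.totalDegree = h₂ at *
  generalize q ^ q.totalDegree = q₂ at *
  generalize δ₀ ^ δ₀.totalDegree = δ₂ at *
  linear_combination (MvPolynomial.C z * ρ * δ₀ * E * q * q₁) * hxh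
    + (MvPolynomial.C z * ρ * δ₀ * E * MvPolynomial.C x * h₂) * hyq
    + (MvPolynomial.C z * ρ * MvPolynomial.C x * MvPolynomial.C y) * hres
    - (MvPolynomial.C x * MvPolynomial.C y * MvPolynomial.C γ * h * q * Δ * ρ) * hzδ
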